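/- Let $H$ be a complex Hilbert space (not necessarily separable), let $k$ be an integer with $1\le k<\dim H$, and let $A=(A_1,\dots,A_m)$ be an $m$-tuple of bounded self-adjoint operators on $H$. For an $m$-tuple $B=(B_1,\dots,B_m)$ of bounded operators on a Hilbert space and $\ell\ge 1$, let $$W_\ell(B)=\Big\{\Big(\sum_{i=1}^{\ell}\langle B_1x_i,x_i\rangle,\dots,\sum_{i=1}^{\ell}\langle B_mx_i,x_i\rangle\Big): x_1,\dots,x_\ell \text{ orthonormal}\Big\}\subseteq\mathbb C^m$$ be its joint $\ell$-numerical range, and let $$W_{\rm ess}(A)=\bigcap\big\{\overline{W_1(A+K)} : K=(K_1,\dots,K_m),\ K_j \text{ compact on } H\big\}$$ be the joint essential numerical range of $A$. Let $H_1$ be the Hilbert space with an orthonormal basis $\{e_\mu:\mu\in W_{\rm ess}(A)\}$, let $D_j$ be the bounded diagonal operator on $H_1$ with $D_je_\mu=\mu_je_\mu$, let $I_k\otimes D_j$ be the orthogonal sum of $k$ copies of $D_j$, acting on the orthogonal sum $H_0$ of $k$ copies of $H_1$, and let $\tilde A=(\tilde A_1,\dots,\tilde A_m)$ with $\tilde A_j=A_j\oplus(I_k\otimes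 D_j)$ on $H\oplus H_0$. Then: 1. for $\ell=1,\dots,k$, $W_\ell(I_k\otimes D_1,\dots,I_k\otimes D_m)=\ell\,W_{\rm ess}(A)=\{\ell\mu:\mu\in W_{\rm ess}(A)\}$; 2. $\overline{W_k(A)}=W_k(\tilde A)$; 3. $W_k(A)$ is closed if and only if $W_k(A)=W_k(\tilde A)$. If $H$ is infinite-dimensional, this is also equivalent to the condition that $W_k(A)$ is exactly the set of all points $$\big({\rm tr}(A_1P),\dots,{\rm tr}(A_mP)\big)+(k-{\rm tr}\,P)\,\xi,$$ where $P$ runs over the positive semidefinite contractions on $H$ of rank at most $k$ and $\xi$ over $W_{\rm ess}(A)$. -/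

import Mathlib

open scoped ENNReal

namespace JointRange

noncomputable section

/-- The joint `k`-numerical range of an `m`-tuple of bounded operators. The inner product of
Mathlib is linear in the second variable. For `k = 0` this is `{0}`. -/
def jointNumericalRange {E : Type*} [NormedAddCommGroup E] [InnerProductSpace ℂ E] {m : ℕ}
    (k : ℕ) (A : Fin m → E →L[ℂ] E) : Set (Fin m → ℂ) :=
  {a | ∃ x : Fin k → E, Orthonormal ℂ x ∧ ∀ j, a j = ∑ i, inner ℂ (x i) (A j (x i))}

/-- The joint essential numerical range: the intersection of the closures of the joint numerical
ranges of all compact perturbations of the tuple. -/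
def essNumericalRange {E : Type*} [NormedAddCommGroup E] [InnerProductSpace ℂ E] {m : ℕ}
    (A : Fin m → E →L[ℂ] E) : Set (Fin m → ℂ) :=
  {μ | ∀ K : Fin m → E →L[ℂ] E, (∀ j, IsCompactOperator (K j)) →
    μ ∈ closure (jointNumericalRange 1 (fun j => A j + K j))}

theorem norm_le_of_mem_essNumericalRange {E : Type*} [NormedAddCommGroup E]
    [InnerProductSpace ℂ E] {m : ℕ} {A : Fin m → E →L[ℂ] E} {μ : Fin m → ℂ}
    (hμ : μ ∈ essNumericalRange A) (j : Fin m) : ‖μ j‖ ≤ ‖A j‖ := by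
  have h := hμ (fun _ => 0) (fun _ => isCompactOperator_zero)
  have hc : IsClosed {a : Fin m → ℂ | ‖a j‖ ≤ ‖A j‖} :=
    isClosed_le (continuous_norm.comp (continuous_apply j)) continuous_const
  refine closure_minimal ?_ hc h
  rintro a ⟨x, hx, ha⟩
  have h1 : ‖x 0‖ = 1 := hx.1 0
  have h2 : a j = inner ℂ (x 0) (A j (x 0)) := by simpa using ha j
  calc ‖a j‖ ≤ ‖x 0‖ * ‖A j (x 0)‖ := by rw [h2]; exact norm_inner_le_norm _ _
    _ ≤ ‖A j‖ := by simpa [h1] using (A j).le_opNorm (x 0)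

/-- The Hilbert space `ℓ²(W_ess(A))`, with an orthonormal basis indexed by the points of the
joint essential numerical range. -/
abbrev EssSpace {E : Type*} [NormedAddCommGroup E] [InnerProductSpace ℂ E] {m : ℕ}
    (A : Fin m → E →L[ℂ] E) : Type :=
  lp (fun _ : essNumericalRange A => ℂ) 2

/-- The diagonal operator `D_j` on `ℓ²(W_ess(A))`, with `D_j e_μ = μ_j e_μ`. -/
def essDiagonal {E : Type*} [NormedAddCommGroup E] [InnerProductSpace ℂ E] {m : ℕ}
    (A : Fin m → E →L[ℂ] E) (j : Fin m) : EssSpace A →L[ℂ] EssSpace A :=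
  lp.mapCLM 2 (fun μ : essNumericalRange A => (μ : Fin m → ℂ) j • ContinuousLinearMap.id ℂ ℂ)
    (norm_nonneg (A j)) (fun μ => by
      rw [norm_smul, ContinuousLinearMap.norm_id, mul_one]
      exact norm_le_of_mem_essNumericalRange μ.2 j)

/-- `I_k ⊗ T`: the orthogonal sum of `k` copies of the operator `T`, acting on the orthogonal sum
of `k` copies of the space. -/
def ampliation {E : Type*} [NormedAddCommGroup E] [InnerProductSpace ℂ E] (k : ℕ)
    (T : E →L[ℂ] E) :
    PiLp 2 (fun _ : Fin k => E) →L[ℂ] PiLp 2 (fun _ : Fin k => E) :=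
  (PiLp.continuousLinearEquiv 2 ℂ (fun _ : Fin k => E)).symm.toContinuousLinearMap ∘L
    (ContinuousLinearMap.pi fun i => T ∘L ContinuousLinearMap.proj i) ∘L
      (PiLp.continuousLinearEquiv 2 ℂ (fun _ : Fin k => E)).toContinuousLinearMap

/-- The direct sum `S ⊕ T` acting on the orthogonal sum of two spaces. -/
def directSum {E F : Type*} [NormedAddCommGroup E] [InnerProductSpace ℂ E]
    [NormedAddCommGroup F] [InnerProductSpace ℂ F] (S : E →L[ℂ] E) (T : F →L[ℂ] F) :
    WithLp 2 (E × F) →L[ℂ] WithLp 2 (E × F) :=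
  (WithLp.prodContinuousLinearEquiv 2 ℂ E F).symm.toContinuousLinearMap ∘L
    (S.prodMap T) ∘L (WithLp.prodContinuousLinearEquiv 2 ℂ E F).toContinuousLinearMap

/-- The tuple `Ã`, with `Ã_j = A_j ⊕ (I_k ⊗ D_j)`. -/
def extendedTuple {E : Type*} [NormedAddCommGroup E] [InnerProductSpace ℂ E] {m : ℕ}
    (k : ℕ) (A : Fin m → E →L[ℂ] E) (j : Fin m) :
    WithLp 2 (E × PiLp 2 (fun _ : Fin k => EssSpace A)) →L[ℂ]
      WithLp 2 (E × PiLp 2 (fun _ : Fin k => EssSpace A)) :=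
  directSum (A j) (ampliation k (essDiagonal A j))

/-- The trace of a finite rank operator: the trace of its restriction to its (finite-dimensional)
range. -/
def finiteRankTrace {E : Type*} [NormedAddCommGroup E] [InnerProductSpace ℂ E]
    (T : E →L[ℂ] E) : ℂ :=
  LinearMap.trace ℂ (LinearMap.range (T : E →ₗ[ℂ] E))
    ((T : E →ₗ[ℂ] E).rangeRestrict ∘ₗ (LinearMap.range (T : E →ₗ[ℂ] E)).subtype)

/-- The set of all points `tr(AP) + (k - tr P) ξ`, where `P` is a positive semidefinite
contraction of rank at most `k` and `ξ` lies in the joint essential numerical range. -/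
def tracePoints {E : Type*} [NormedAddCommGroup E] [InnerProductSpace ℂ E] {m : ℕ}
    (k : ℕ) (A : Fin m → E →L[ℂ] E) : Set (Fin m → ℂ) :=
  {a | ∃ P : E →L[ℂ] E, P.IsPositive ∧ ‖P‖ ≤ 1 ∧ LinearMap.rank (P : E →ₗ[ℂ] E) ≤ (k : Cardinal) ∧
    ∃ ξ ∈ essNumericalRange A,
      ∀ j, a j = finiteRankTrace (A j ∘L P) + ((k : ℂ) - finiteRankTrace P) * ξ j}

end

end JointRange

namespace JointRange

open Filter Topology Pointwise

/-! The extended range and the closure are both identified with one set, `compressionPoints`.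
Compressing `k` orthonormal vectors of `H ⊕ H₀` to `H` leaves vectors `x_i` whose Gram matrix is at
most the identity. The `H₀` components carry the missing Gram matrix, and there the diagonal
operators only average points of `W_ess(A)`. Since `W_ess(A)` is convex and compact, these averages
add up to `(∑ ‖y_i‖²) ξ` with a single essential `ξ` (`jointNumericalRange_extendedTuple`).

A limit of points of `W_k(A)` has the same shape: orthonormal systems converge weakly to such `x_i`,
and the value lost in the limit is `1 - ‖x_i‖²` times an essential point
(`exists_quadraticValue_defect`, `closure_subset_compressionPoints`). Conversely, the missing Gram
matrix can be realized inside `H`, on orthonormal vectors orthogonal to all `x_i` and `A_j x_i` with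
values near `ξ` (`compressionPoints_subset_closure`).

The tool for this, when `H` is infinite-dimensional, is a description of `W_ess(A)` by cluster
points of `⟨x, A_j x⟩` along unit vectors eventually orthogonal to each fixed vector
(`essNumericalRange_eq_asymptoticRange`). Filters and ultrafilters take the place of sequences, so
separability plays no role. In finite dimension `W_k(A)` is compact and, unless `m = 0`, `W_ess(A)`
is empty.

Closedness then follows formally, and writing `P = ∑ ⟨x_i, ·⟩ x_i` turns `compressionPoints` into
`tracePoints`. -/

/-- The tuple of values `⟨x, A_j x⟩`. -/
noncomputable def quadraticValue {E : Type*} [NormedAddCommGroup E] [InnerProductSpace ℂ E] {m : ℕ}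
    (A : Fin m → E →L[ℂ] E) (x : E) : Fin m → ℂ := fun j => inner ℂ x (A j x)

/-! ### The essential range as an asymptotic range. -/

section EssentialRange

variable {E : Type*} [NormedAddCommGroup E] [InnerProductSpace ℂ E] {m : ℕ}

lemma inner_self_eq_ofReal_norm_sq (x : E) : inner ℂ x x = ((‖x‖ ^ 2 : ℝ) : ℂ) := by
  rw [inner_self_eq_norm_sq_to_K]
  push_cast
  rfl

lemma quadraticValue_add (A B : Fin m → E →L[ℂ] E) (x : E) :
    quadraticValue (fun j => A j + B j) x = quadraticValue A x + quadraticValue B x := by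
  funext j
  simp [quadraticValue]

lemma quadraticValue_smul (A : Fin m → E →L[ℂ] E) (c : ℂ) (x : E) :
    quadraticValue A (c • x) = (‖c‖ ^ 2 : ℝ) • quadraticValue A x := by
  funext j
  simp only [quadraticValue, map_smul, inner_smul_left, inner_smul_right, Pi.smul_apply,
    Complex.real_smul]
  rw [← mul_assoc, Complex.mul_conj']
  push_cast
  rfl

lemma norm_quadraticValue_apply_le (A : Fin m → E →L[ℂ] E) (x : E) (j : Fin m) :
    ‖quadraticValue A x j‖ ≤ ‖A j‖ * ‖x‖ ^ 2 :=
  calc ‖quadraticValue A x j‖ ≤ ‖x‖ * ‖A j x‖ := norm_inner_le_norm _ _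
    _ ≤ ‖x‖ * (‖A j‖ * ‖x‖) := by gcongr; exact (A j).le_opNorm x
    _ = ‖A j‖ * ‖x‖ ^ 2 := by ring

lemma mem_jointNumericalRange_one_iff {A : Fin m → E →L[ℂ] E} {a : Fin m → ℂ} :
    a ∈ jointNumericalRange 1 A ↔ ∃ x : E, ‖x‖ = 1 ∧ a = quadraticValue A x := by
  constructor
  · rintro ⟨x, hx, h⟩
    exact ⟨x 0, hx.1 0, funext fun j => by simpa [quadraticValue] using h j⟩
  · rintro ⟨x, hx, rfl⟩
    refine ⟨fun _ => x, ⟨fun _ => hx, fun i j hij => (hij (Subsingleton.elim i j)).elim⟩, ?_⟩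
    intro j
    simp [quadraticValue]

lemma smul_quadraticValue_mem_jointNumericalRange (A : Fin m → E →L[ℂ] E) {x : E} (hx : x ≠ 0) :
    (‖x‖ ^ 2)⁻¹ • quadraticValue A x ∈ jointNumericalRange 1 A := by
  rw [mem_jointNumericalRange_one_iff]
  have h : ‖x‖ ≠ 0 := norm_ne_zero_iff.2 hx
  refine ⟨((‖x‖⁻¹ : ℝ) : ℂ) • x, ?_, ?_⟩
  · rw [norm_smul, Complex.norm_real, norm_inv, norm_norm, inv_mul_cancel₀ h]
  · rw [quadraticValue_smul, Complex.norm_real, norm_inv, norm_norm, inv_pow]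

/-- `K` maps a ball into a compact set, so `K (r n)` has a norm limit `y` along the ultrafilter. The
remainder is controlled by boundedness, and `⟨r n, y⟩` vanishes by weak nullity. -/
lemma tendsto_inner_compactOperator {ι : Type*} {U : Ultrafilter ι} {r : ι → E} {C : ℝ}
    (hC : ∀ᶠ n in (U : Filter ι), ‖r n‖ ≤ C)
    (h0 : ∀ h : E, Tendsto (fun n => inner ℂ h (r n)) U (𝓝 0)) {K : E →L[ℂ] E}
    (hK : IsCompactOperator K) : Tendsto (fun n => inner ℂ (r n) (K (r n))) U (𝓝 0) := by
  obtain ⟨T, hT, hsub⟩ := hK.image_closedBall_subset_compact (f := (K : E →ₗ[ℂ] E)) C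
  have hmem : ∀ᶠ n in (U : Filter ι), K (r n) ∈ T := by
    filter_upwards [hC] with n hn
    exact hsub ⟨r n, by simpa using hn, rfl⟩
  obtain ⟨y, -, hy⟩ := hT.ultrafilter_le_nhds (U.map fun n => K (r n))
    (le_principal_iff.2 hmem)
  have hy' : Tendsto (fun n => K (r n)) U (𝓝 y) := hy
  have h1 : Tendsto (fun n => inner ℂ (r n) (K (r n) - y)) U (𝓝 0) := by
    have h2 : Tendsto (fun n => C * ‖K (r n) - y‖) U (𝓝 0) := by
      have := ((hy'.sub_const y).norm).const_mul C
      simpa using this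
    refine squeeze_zero_norm' ?_ h2
    filter_upwards [hC] with n hn
    exact (norm_inner_le_norm _ _).trans (by gcongr)
  have h3 : Tendsto (fun n => inner ℂ (r n) y) U (𝓝 0) := by
    have := (Complex.continuous_conj.tendsto _).comp (h0 y)
    simpa [Function.comp_def] using this
  have h4 := h1.add h3
  simpa [inner_sub_right] using h4

/-- Normalized limits of the quadratic values along a weakly null family are essential. -/
lemma mem_essNumericalRange_of_weakly_null {A : Fin m → E →L[ℂ] E} {ι : Type*} {U : Ultrafilter ι}
    {r : ι → E} {C : ℝ} (hC : ∀ᶠ n in (U : Filter ι), ‖r n‖ ≤ C)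
    (h0 : ∀ h : E, Tendsto (fun n => inner ℂ h (r n)) U (𝓝 0)) {s : ℝ} (hs0 : s ≠ 0)
    (hs : Tendsto (fun n => ‖r n‖ ^ 2) U (𝓝 s)) {v : Fin m → ℂ}
    (hv : Tendsto (fun n => quadraticValue A (r n)) U (𝓝 v)) :
    s⁻¹ • v ∈ essNumericalRange A := by
  intro K hK
  have h1 : Tendsto (fun n => quadraticValue (fun j => A j + K j) (r n)) U (𝓝 v) := by
    simp_rw [quadraticValue_add]
    have h2 : Tendsto (fun n => quadraticValue K (r n)) U (𝓝 0) :=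
      tendsto_pi_nhds.2 fun j => tendsto_inner_compactOperator hC h0 (hK j)
    simpa using hv.add h2
  refine mem_closure_of_tendsto ((hs.inv₀ hs0).smul h1) ?_
  filter_upwards [hs.eventually_ne hs0] with n hn
  exact smul_quadraticValue_mem_jointNumericalRange _ fun h => hn (by simp [h])

lemma isClosed_essNumericalRange (A : Fin m → E →L[ℂ] E) : IsClosed (essNumericalRange A) := by
  have h : essNumericalRange A = ⋂ K : Fin m → E →L[ℂ] E, ⋂ _ : ∀ j, IsCompactOperator (K j),
      closure (jointNumericalRange 1 (fun j => A j + K j)) := by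
    ext μ
    simp [essNumericalRange]
  rw [h]
  exact isClosed_iInter fun K => isClosed_iInter fun _ => isClosed_closure

lemma isCompact_essNumericalRange (A : Fin m → E →L[ℂ] E) : IsCompact (essNumericalRange A) := by
  refine (isCompact_univ_pi fun j => isCompact_closedBall (0 : ℂ) ‖A j‖).of_isClosed_subset
    (isClosed_essNumericalRange A) fun μ hμ j _ => ?_
  simpa using norm_le_of_mem_essNumericalRange hμ j

/-- The filter generated by the unit spheres of orthogonal complements of finite sets. -/
def awayFilter (E : Type*) [NormedAddCommGroup E] [InnerProductSpace ℂ E] : Filter E :=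
  ⨅ s : Finset E, 𝓟 {x | ‖x‖ = 1 ∧ ∀ y ∈ s, inner ℂ y x = 0}

lemma hasBasis_awayFilter : (awayFilter E).HasBasis (fun _ : Finset E => True)
    fun s => {x | ‖x‖ = 1 ∧ ∀ y ∈ s, inner ℂ y x = 0} := by
  classical
  refine hasBasis_iInf_principal fun s t => ⟨s ∪ t, ?_, ?_⟩
  · exact fun x hx => ⟨hx.1, fun y hy => hx.2 y (Finset.mem_union_left _ hy)⟩
  · exact fun x hx => ⟨hx.1, fun y hy => hx.2 y (Finset.mem_union_right _ hy)⟩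

lemma eventually_awayFilter_norm : ∀ᶠ x in awayFilter E, ‖x‖ = 1 :=
  hasBasis_awayFilter.eventually_iff.2 ⟨∅, trivial, fun _ hx => hx.1⟩

lemma eventually_awayFilter_inner (y : E) : ∀ᶠ x in awayFilter E, inner ℂ y x = 0 :=
  hasBasis_awayFilter.eventually_iff.2 ⟨{y}, trivial, fun _ hx => hx.2 y (by simp)⟩

lemma awayFilter_neBot (hE : ¬ FiniteDimensional ℂ E) : (awayFilter E).NeBot := by
  refine hasBasis_awayFilter.neBot_iff.2 fun {s} _ => ?_
  have hne : (Submodule.span ℂ (s : Set E))ᗮ ≠ ⊥ := by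
    intro h
    rw [Submodule.orthogonal_eq_bot_iff] at h
    exact hE (Module.finite_def.2 (h ▸ Submodule.fg_span s.finite_toSet))
  obtain ⟨x, hx, hx0⟩ := Submodule.exists_mem_ne_zero_of_ne_bot hne
  refine ⟨((‖x‖⁻¹ : ℝ) : ℂ) • x, ?_, fun y hy => ?_⟩
  · rw [norm_smul, Complex.norm_real, norm_inv, norm_norm,
      inv_mul_cancel₀ (norm_ne_zero_iff.2 hx0)]
  · rw [inner_smul_right, hx y (Submodule.subset_span hy), mul_zero]

/-- The cluster points of the quadratic values along the filter of unit vectors away from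
finite sets. -/
def asymptoticRange (A : Fin m → E →L[ℂ] E) : Set (Fin m → ℂ) :=
  {μ | MapClusterPt μ (awayFilter E) (quadraticValue A)}

lemma mem_asymptoticRange_iff {A : Fin m → E →L[ℂ] E} {μ : Fin m → ℂ} :
    μ ∈ asymptoticRange A ↔ ∀ ε > 0, ∃ᶠ x in awayFilter E, dist (quadraticValue A x) μ < ε :=
  Metric.nhds_basis_ball.mapClusterPt_iff_frequently

lemma exists_of_mem_asymptoticRange {A : Fin m → E →L[ℂ] E} {μ : Fin m → ℂ}
    (hμ : μ ∈ asymptoticRange A) (s : Finset E) {ε : ℝ} (hε : 0 < ε) :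
    ∃ x : E, ‖x‖ = 1 ∧ (∀ y ∈ s, inner ℂ y x = 0) ∧ dist (quadraticValue A x) μ < ε := by
  obtain ⟨x, h1, h2⟩ := ((mem_asymptoticRange_iff.1 hμ ε hε).and_eventually
    (hasBasis_awayFilter.mem_of_mem (i := s) trivial)).exists
  exact ⟨x, h2.1, h2.2, h1⟩

lemma mem_asymptoticRange_of_tendsto {A : Fin m → E →L[ℂ] E} {μ : Fin m → ℂ} {U : Ultrafilter E}
    (hU : (U : Filter E) ≤ awayFilter E) (h : Tendsto (quadraticValue A) U (𝓝 μ)) :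
    μ ∈ asymptoticRange A :=
  mapClusterPt_iff_ultrafilter.2 ⟨U, hU, h⟩

lemma exists_tendsto_quadraticValue (A : Fin m → E →L[ℂ] E) {U : Ultrafilter E}
    (hU : (U : Filter E) ≤ awayFilter E) :
    ∃ μ ∈ asymptoticRange A, Tendsto (quadraticValue A) U (𝓝 μ) := by
  have hK : IsCompact (Set.univ.pi fun j => Metric.closedBall (0 : ℂ) ‖A j‖) :=
    isCompact_univ_pi fun j => isCompact_closedBall (0 : ℂ) ‖A j‖
  obtain ⟨μ, -, hμ⟩ := hK.ultrafilter_le_nhds (U.map (quadraticValue A)) (by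
    refine le_principal_iff.2 (hU (Filter.mem_of_superset eventually_awayFilter_norm ?_))
    intro x hx j _
    have hx' : ‖x‖ = 1 := hx
    simpa [hx'] using norm_quadraticValue_apply_le A x j)
  exact ⟨μ, mem_asymptoticRange_of_tendsto hU hμ, hμ⟩

lemma asymptoticRange_nonempty (hE : ¬ FiniteDimensional ℂ E) (A : Fin m → E →L[ℂ] E) :
    (asymptoticRange A).Nonempty := by
  have := awayFilter_neBot hE
  obtain ⟨μ, hμ, -⟩ := exists_tendsto_quadraticValue A (Ultrafilter.of_le (awayFilter E))
  exact ⟨μ, hμ⟩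

lemma asymptoticRange_subset (A : Fin m → E →L[ℂ] E) :
    asymptoticRange A ⊆ essNumericalRange A := by
  intro μ hμ
  obtain ⟨U, hU, h⟩ := mapClusterPt_iff_ultrafilter.1 hμ
  have h1 := mem_essNumericalRange_of_weakly_null (A := A) (U := U) (r := fun x => x) (C := 1)
    (s := 1) (v := μ) ?_ ?_ one_ne_zero ?_ h
  · simpa using h1
  · filter_upwards [hU eventually_awayFilter_norm] with x hx using le_of_eq hx
  · intro y
    refine tendsto_const_nhds.congr' ?_
    filter_upwards [hU (eventually_awayFilter_inner y)] with x hx using Eq.symm hx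
  · refine tendsto_const_nhds.congr' ?_
    filter_upwards [hU eventually_awayFilter_norm] with x hx
    have hx' : ‖x‖ = 1 := hx
    rw [hx', one_pow]

lemma isClosed_asymptoticRange (A : Fin m → E →L[ℂ] E) : IsClosed (asymptoticRange A) :=
  isClosed_setOfPred_clusterPt

lemma quadraticValue_add_of_inner_eq_zero {A : Fin m → E →L[ℂ] E}
    (hA : ∀ j, ((A j : E →L[ℂ] E) : E →ₗ[ℂ] E).IsSymmetric) {x y : E}
    (h : ∀ j, inner ℂ (A j x) y = 0) :
    quadraticValue A (x + y) = quadraticValue A x + quadraticValue A y := by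
  funext j
  have h1 : inner ℂ x (A j y) = 0 := by rw [← h j]; exact (hA j x y).symm
  have h2 : inner ℂ y (A j x) = 0 := by rw [← inner_conj_symm, h j, map_zero]
  simp only [quadraticValue, Pi.add_apply, map_add, inner_add_left, inner_add_right, h1, h2]
  ring

/-- If `y` is chosen orthogonal to `x` and to every `A_j x`, all cross terms vanish, and `√a x + √b
y` is a unit vector whose value is the convex combination. -/
lemma convex_asymptoticRange {A : Fin m → E →L[ℂ] E}
    (hA : ∀ j, ((A j : E →L[ℂ] E) : E →ₗ[ℂ] E).IsSymmetric) :
    Convex ℝ (asymptoticRange A) := by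
  classical
  intro μ hμ ν hν a b ha hb hab
  refine mem_asymptoticRange_iff.2 fun ε hε => hasBasis_awayFilter.frequently_iff.2 fun {s} _ => ?_
  obtain ⟨x, hx1, hxs, hx⟩ := exists_of_mem_asymptoticRange hμ s hε
  obtain ⟨y, hy1, hys, hy⟩ := exists_of_mem_asymptoticRange hν
    (s ∪ {x} ∪ Finset.univ.image fun j => A j x) hε
  have hxy : inner ℂ x y = 0 := hys x (by simp)
  have hAxy : ∀ j, inner ℂ (A j x) y = 0 := fun j => hys _ (by simp)
  have hn : ∀ t : ℝ, 0 ≤ t → ‖((√t : ℝ) : ℂ)‖ ^ 2 = t := fun t ht => by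
    rw [Complex.norm_real, Real.norm_eq_abs, sq_abs, Real.sq_sqrt ht]
  have hq : quadraticValue A (((√a : ℝ) : ℂ) • x + ((√b : ℝ) : ℂ) • y) =
      a • quadraticValue A x + b • quadraticValue A y := by
    rw [quadraticValue_add_of_inner_eq_zero hA, quadraticValue_smul, quadraticValue_smul, hn a ha,
      hn b hb]
    intro j
    rw [map_smul, inner_smul_left, inner_smul_right, hAxy, mul_zero, mul_zero]
  refine ⟨((√a : ℝ) : ℂ) • x + ((√b : ℝ) : ℂ) • y, ⟨?_, fun z hz => ?_⟩, ?_⟩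
  · have h1 := norm_add_sq_eq_norm_sq_add_norm_sq_of_inner_eq_zero (𝕜 := ℂ)
      (((√a : ℝ) : ℂ) • x) (((√b : ℝ) : ℂ) • y)
      (by rw [inner_smul_left, inner_smul_right, hxy, mul_zero, mul_zero])
    rw [← sq, ← sq, ← sq, norm_smul, norm_smul, hx1, hy1, mul_one, mul_one, hn a ha, hn b hb,
      hab] at h1
    exact (pow_eq_one_iff_of_nonneg (norm_nonneg _) two_ne_zero).1 h1
  · rw [inner_add_right, inner_smul_right, inner_smul_right, hxs z hz,
      hys z (by simp [hz]), mul_zero, mul_zero, add_zero]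
  · rw [hq]
    have h3 := (convex_ball (0 : Fin m → ℂ) ε) (mem_ball_zero_iff.2 (by rwa [← dist_eq_norm]))
      (mem_ball_zero_iff.2 (by rwa [← dist_eq_norm])) ha hb hab
      (x := quadraticValue A x - μ) (y := quadraticValue A y - ν)
    rw [mem_ball_zero_iff] at h3
    rw [dist_eq_norm]
    have h4 : a • quadraticValue A x + b • quadraticValue A y - (a • μ + b • ν) =
        a • (quadraticValue A x - μ) + b • (quadraticValue A y - ν) := by module
    rwa [h4]

lemma isCompactOperator_starProjection (F : Submodule ℂ E) [FiniteDimensional ℂ F] :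
    IsCompactOperator F.starProjection := by
  have : ProperSpace F := FiniteDimensional.proper ℂ F
  have h : IsCompactOperator (F.orthogonalProjectionOnto : E →L[ℂ] F) :=
    isCompactOperator_of_locallyCompactSpace_dom F.orthogonalProjectionOnto
  exact h.clm_comp F.subtypeL

/-- A finite rank perturbation of `A` compresses it to the orthogonal complement of a
finite-dimensional subspace and replaces it there by a scalar. -/
lemma exists_compact_perturbation (A : Fin m → E →L[ℂ] E) (F : Submodule ℂ E)
    [FiniteDimensional ℂ F] (σ : Fin m → ℂ) :
    ∃ K : Fin m → E →L[ℂ] E, (∀ j, IsCompactOperator (K j)) ∧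
      ∀ y, quadraticValue (fun j => A j + K j) y =
        quadraticValue A (Fᗮ.starProjection y) + (‖F.starProjection y‖ ^ 2) • σ := by
  -- Solved from `A_j + K_j = Q A_j Q + σ_j P` with `P`, `Q` the projections onto `F`, `Fᗮ`; every
  -- term of `K_j` contains the factor `P`.
  refine ⟨fun j => σ j • F.starProjection - F.starProjection ∘L A j ∘L Fᗮ.starProjection
    - A j ∘L F.starProjection, fun j => ?_, fun y => ?_⟩
  · have hF := isCompactOperator_starProjection F
    exact ((hF.smul (σ j)).sub (hF.comp_clm (A j ∘L Fᗮ.starProjection))).sub (hF.clm_comp (A j))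
  · funext j
    have h1 : y = F.starProjection y + Fᗮ.starProjection y :=
      (F.starProjection_add_starProjection_orthogonal y).symm
    have h2 : ∀ z, z - F.starProjection z = Fᗮ.starProjection z := fun z => by
      rw [Submodule.starProjection_orthogonal_val]
    have h3 : A j y + (σ j • F.starProjection y - F.starProjection (A j (Fᗮ.starProjection y))
        - A j (F.starProjection y)) =
        Fᗮ.starProjection (A j (Fᗮ.starProjection y)) + σ j • F.starProjection y := by
      rw [← h2 (A j (Fᗮ.starProjection y))]
      have h4 : A j y = A j (F.starProjection y) + A j (Fᗮ.starProjection y) := by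
        rw [← map_add, ← h1]
      rw [h4]
      abel
    simp only [quadraticValue, Pi.add_apply, Pi.smul_apply, add_apply, sub_apply, smul_apply,
      ContinuousLinearMap.comp_apply]
    rw [h3, inner_add_right, inner_smul_right, ← Submodule.inner_starProjection_left_eq_right]
    have h5 : inner ℂ y (F.starProjection y) = ((‖F.starProjection y‖ ^ 2 : ℝ) : ℂ) := by
      have h6 : inner ℂ (F.starProjection y) (F.starProjection y) =
          inner ℂ y (F.starProjection y) := by
        rw [Submodule.inner_starProjection_left_eq_right,
          Submodule.starProjection_eq_self_iff.2 (F.starProjection_apply_mem y)]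
      rw [← h6, inner_self_eq_ofReal_norm_sq]
    rw [h5, Complex.real_smul, mul_comm (σ j)]

/-- A point outside the closed convex asymptotic range is separated from it by a half-space `f ≤ u`.
A suitable finite rank perturbation puts the whole numerical range into that half-space, so the
point is not essential. -/
lemma essNumericalRange_subset (hE : ¬ FiniteDimensional ℂ E) {A : Fin m → E →L[ℂ] E}
    (hA : ∀ j, ((A j : E →L[ℂ] E) : E →ₗ[ℂ] E).IsSymmetric) :
    essNumericalRange A ⊆ asymptoticRange A := by
  intro μ hμ
  by_contra hn
  obtain ⟨f, u, hfu, hu⟩ := geometric_hahn_banach_closed_point (convex_asymptoticRange hA)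
    (isClosed_asymptoticRange A) hn
  -- Otherwise an ultrafilter on the set where `f ≥ u` would produce an asymptotic point violating
  -- the separation.
  have hev : ∀ᶠ x in awayFilter E, f (quadraticValue A x) < u := by
    by_contra hcon
    rw [not_eventually, frequently_iff_neBot] at hcon
    obtain ⟨U, hUf⟩ := Ultrafilter.exists_le (f := _) (h := hcon)
    obtain ⟨hU, hUf⟩ := le_inf_iff.1 hUf
    obtain ⟨ξ, hξ, hlim⟩ := exists_tendsto_quadraticValue A hU
    exact (hfu ξ hξ).not_ge (ge_of_tendsto ((f.continuous.tendsto ξ).comp hlim)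
      (Filter.mem_of_superset (le_principal_iff.1 hUf) fun x hx => not_lt.1 hx))
  obtain ⟨s, -, hs⟩ := hasBasis_awayFilter.eventually_iff.1 hev
  have := awayFilter_neBot hE
  obtain ⟨x₀, hx₀⟩ := hev.exists
  have : FiniteDimensional ℂ (Submodule.span ℂ (s : Set E)) :=
    FiniteDimensional.span_finset ℂ s
  -- The scalar put on `F` is the value at `x₀`, itself in the half-space, so both summands of the
  -- perturbed form obey the bound `u`.
  obtain ⟨K, hK, hAK⟩ := exists_compact_perturbation A (Submodule.span ℂ (s : Set E))
    (quadraticValue A x₀)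
  set F := Submodule.span ℂ (s : Set E)
  have hP : ∀ z ∈ Fᗮ, f (quadraticValue A z) ≤ ‖z‖ ^ 2 * u := by
    intro z hz
    rcases eq_or_ne z 0 with rfl | hz0
    · have : quadraticValue A 0 = 0 := by funext j; simp [quadraticValue]
      simp [this]
    have hz' : ‖z‖ ≠ 0 := norm_ne_zero_iff.2 hz0
    have h1 := @hs (((‖z‖⁻¹ : ℝ) : ℂ) • z) ⟨?_, fun y hy => ?_⟩
    · rw [quadraticValue_smul, Complex.norm_real, norm_inv, norm_norm, map_smul, smul_eq_mul,
        inv_pow, inv_mul_lt_iff₀ (by positivity)] at h1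
      exact h1.le
    · rw [norm_smul, Complex.norm_real, norm_inv, norm_norm, inv_mul_cancel₀ hz']
    · rw [inner_smul_right, hz y (Submodule.subset_span hy), mul_zero]
  have hcl : closure (jointNumericalRange 1 (fun j => A j + K j)) ⊆ {w | f w ≤ u} := by
    refine closure_minimal ?_ (isClosed_le f.continuous continuous_const)
    intro w hw
    obtain ⟨y, hy, rfl⟩ := mem_jointNumericalRange_one_iff.1 hw
    have hnorm : ‖F.starProjection y‖ ^ 2 + ‖Fᗮ.starProjection y‖ ^ 2 = 1 := by
      rw [← Submodule.norm_sq_eq_add_norm_sq_starProjection, hy, one_pow]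
    simp only [Set.mem_ofPred_eq]
    rw [hAK, map_add, map_smul, smul_eq_mul]
    have h1 := hP _ (Fᗮ.starProjection_apply_mem y)
    have h2 : ‖F.starProjection y‖ ^ 2 * f (quadraticValue A x₀) ≤ ‖F.starProjection y‖ ^ 2 * u :=
      by gcongr
    calc _ ≤ ‖Fᗮ.starProjection y‖ ^ 2 * u + ‖F.starProjection y‖ ^ 2 * u := add_le_add h1 h2
      _ = (‖F.starProjection y‖ ^ 2 + ‖Fᗮ.starProjection y‖ ^ 2) * u := by ring
      _ = u := by rw [hnorm, one_mul]
  exact (hcl (hμ K hK)).not_gt hu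

lemma essNumericalRange_eq_asymptoticRange (hE : ¬ FiniteDimensional ℂ E) {A : Fin m → E →L[ℂ] E}
    (hA : ∀ j, ((A j : E →L[ℂ] E) : E →ₗ[ℂ] E).IsSymmetric) :
    essNumericalRange A = asymptoticRange A :=
  (essNumericalRange_subset hE hA).antisymm (asymptoticRange_subset A)

lemma essNumericalRange_subset_zero [FiniteDimensional ℂ E] (A : Fin m → E →L[ℂ] E) :
    essNumericalRange A ⊆ {0} := by
  intro μ hμ
  have h := hμ (fun j => -A j) fun j => isCompactOperator_of_locallyCompactSpace_rng _
  refine closure_minimal ?_ isClosed_singleton h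
  intro a ha
  obtain ⟨x, -, rfl⟩ := mem_jointNumericalRange_one_iff.1 ha
  funext j
  simp [quadraticValue]

/-- The perturbations `-A` and `1 - A` are both compact and force the point to be `0` and `1` at
once; this is a contradiction only when there is a coordinate. -/
lemma essNumericalRange_eq_empty [FiniteDimensional ℂ E] [NeZero m] (A : Fin m → E →L[ℂ] E) :
    essNumericalRange A = ∅ := by
  refine Set.eq_empty_of_forall_notMem fun μ hμ => ?_
  have h := hμ (fun j => ContinuousLinearMap.id ℂ E - A j)
    fun j => isCompactOperator_of_locallyCompactSpace_rng _
  have h1 : μ ∈ ({1} : Set (Fin m → ℂ)) := by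
    refine closure_minimal ?_ isClosed_singleton h
    intro a ha
    obtain ⟨x, hx, rfl⟩ := mem_jointNumericalRange_one_iff.1 ha
    funext j
    simp [quadraticValue, hx]
  have h2 := essNumericalRange_subset_zero A hμ
  rw [Set.mem_singleton_iff] at h1 h2
  exact one_ne_zero (congrFun (h1.symm.trans h2) (0 : Fin m))

lemma convex_essNumericalRange {A : Fin m → E →L[ℂ] E}
    (hA : ∀ j, ((A j : E →L[ℂ] E) : E →ₗ[ℂ] E).IsSymmetric) :
    Convex ℝ (essNumericalRange A) := by
  by_cases hE : FiniteDimensional ℂ E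
  · exact (Set.subsingleton_singleton.anti (essNumericalRange_subset_zero A)).convex
  · rw [essNumericalRange_eq_asymptoticRange hE hA]
    exact convex_asymptoticRange hA

lemma essNumericalRange_nonempty (hE : ¬ FiniteDimensional ℂ E) (A : Fin m → E →L[ℂ] E) :
    (essNumericalRange A).Nonempty :=
  (asymptoticRange_nonempty hE A).mono (asymptoticRange_subset A)

end EssentialRange

/-! ### Dilates of convex and compact sets. -/

section Cone

variable {V : Type*} [NormedAddCommGroup V] [NormedSpace ℝ V] {W : Set V}

/-- Convexity gives `s • W + t • W = (s + t) • W` for `s, t ≥ 0`. This merges several essential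
points into one; nonemptiness is needed for `0 • W = {0}`. -/
lemma sum_mem_smul_of_convex (hW : Convex ℝ W) (hne : W.Nonempty) {ι : Type*} (t : Finset ι)
    {s : ι → ℝ} {v : ι → V} (hs : ∀ i ∈ t, 0 ≤ s i) (hv : ∀ i ∈ t, v i ∈ s i • W) :
    ∑ i ∈ t, v i ∈ (∑ i ∈ t, s i) • W := by
  classical
  induction t using Finset.induction_on with
  | empty =>
    simp [Set.zero_smul_set hne]
  | insert a t ha ih =>
    rw [Finset.sum_insert ha, Finset.sum_insert ha,
      hW.add_smul (hs a (by simp)) (Finset.sum_nonneg fun i hi => hs i (by simp [hi]))]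
    exact Set.add_mem_add (hv a (by simp))
      (ih (fun i hi => hs i (by simp [hi])) fun i hi => hv i (by simp [hi]))

lemma mem_smul_of_tendsto (hW : IsCompact W) {ι : Type*} {l : Filter ι} [l.NeBot] {s : ι → ℝ}
    {v : ι → V} {s₀ : ℝ} {v₀ : V} (hs : Tendsto s l (𝓝 s₀)) (hv : Tendsto v l (𝓝 v₀))
    (h : ∀ n, v n ∈ s n • W) : v₀ ∈ s₀ • W := by
  choose ξ hξ hξv using h
  have hmem : ∀ᶠ n in (Ultrafilter.of l : Filter ι), ξ n ∈ W := Eventually.of_forall hξ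
  obtain ⟨η, hη, hlim⟩ := hW.ultrafilter_le_nhds ((Ultrafilter.of l).map ξ)
    (le_principal_iff.2 hmem)
  have hlim' : Tendsto ξ (Ultrafilter.of l) (𝓝 η) := hlim
  have h1 := (hs.mono_left (Ultrafilter.of_le l)).smul hlim'
  refine ⟨η, hη, tendsto_nhds_unique h1 ?_⟩
  exact (hv.mono_left (Ultrafilter.of_le l)).congr fun n => (hξv n).symm

end Cone

/-! ### Completing a Gram matrix to the identity. -/

section Gram

variable {E F : Type*} [NormedAddCommGroup E] [InnerProductSpace ℂ E]
  [NormedAddCommGroup F] [InnerProductSpace ℂ F] {k : ℕ}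

/-- The Gram matrices of the two tuples add up to the identity. -/
def GramComplement (x : Fin k → E) (y : Fin k → F) : Prop :=
  ∀ i l, inner ℂ (x i) (x l) + inner ℂ (y i) (y l) = if i = l then 1 else 0

lemma GramComplement.norm_sq_add {x : Fin k → E} {y : Fin k → F} (h : GramComplement x y)
    (c : Fin k → ℂ) :
    ‖∑ i, c i • x i‖ ^ 2 + ‖∑ i, c i • y i‖ ^ 2 = ∑ i, ‖c i‖ ^ 2 := by
  have h1 : ∀ i l : Fin k, inner ℂ (c i • x i) (c l • x l) + inner ℂ (c i • y i) (c l • y l) =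
      if i = l then ((‖c i‖ ^ 2 : ℝ) : ℂ) else 0 := fun i l => by
    rw [inner_smul_left, inner_smul_left, inner_smul_right, inner_smul_right, ← mul_add, ← mul_add,
      h i l]
    split_ifs with hil
    · subst hil
      rw [mul_one, Complex.conj_mul']
      push_cast
      rfl
    · simp
  have h2 : inner ℂ (∑ i, c i • x i) (∑ i, c i • x i) + inner ℂ (∑ i, c i • y i) (∑ i, c i • y i) =
      ((∑ i, ‖c i‖ ^ 2 : ℝ) : ℂ) := by
    simp_rw [sum_inner, inner_sum]
    rw [← Finset.sum_add_distrib]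
    simp_rw [← Finset.sum_add_distrib, h1]
    simp
  rw [inner_self_eq_ofReal_norm_sq, inner_self_eq_ofReal_norm_sq] at h2
  exact_mod_cast h2

lemma GramComplement.norm_sq {x : Fin k → E} {y : Fin k → F} (h : GramComplement x y)
    (i : Fin k) : ‖x i‖ ^ 2 + ‖y i‖ ^ 2 = 1 := by
  have h1 := h i i
  rw [inner_self_eq_ofReal_norm_sq, inner_self_eq_ofReal_norm_sq, if_pos rfl] at h1
  exact_mod_cast h1

/-- The hypothesis says that `1 - gram x` is positive semidefinite, so it factors as `B* B`; the
columns of `B` are the vectors `y i`. -/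
lemma exists_gramComplement (x : Fin k → E)
    (hx : ∀ c : Fin k → ℂ, ‖∑ i, c i • x i‖ ^ 2 ≤ ∑ i, ‖c i‖ ^ 2) :
    ∃ y : Fin k → EuclideanSpace ℂ (Fin k), GramComplement x y := by
  open scoped MatrixOrder Matrix.Norms.L2Operator ComplexOrder in
  have hM : (1 - Matrix.gram ℂ x).PosSemidef := by
    refine .of_dotProduct_mulVec_nonneg (Matrix.isHermitian_one.sub (Matrix.isHermitian_gram ℂ x))
      fun c => ?_
    have h1 : star c ⬝ᵥ ((1 - Matrix.gram ℂ x).mulVec c) =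
        ((∑ i, ‖c i‖ ^ 2 - ‖∑ i, c i • x i‖ ^ 2 : ℝ) : ℂ) := by
      rw [Matrix.sub_mulVec, dotProduct_sub, Matrix.star_dotProduct_gram_mulVec,
        Matrix.one_mulVec, inner_self_eq_ofReal_norm_sq]
      simp [dotProduct, Complex.conj_mul']
    rw [h1]
    exact_mod_cast sub_nonneg.2 (hx c)
  obtain ⟨B, hB⟩ := CStarAlgebra.nonneg_iff_eq_star_mul_self.mp hM.nonneg
  refine ⟨fun i => WithLp.toLp 2 fun a => B a i, fun i l => ?_⟩
  have h1 := congrFun (congrFun hB i) l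
  rw [Matrix.sub_apply, Matrix.gram_apply, Matrix.one_apply] at h1
  have h2 : inner ℂ (WithLp.toLp 2 fun a => B a i : EuclideanSpace ℂ (Fin k))
      (WithLp.toLp 2 fun a => B a l) = (star B * B) i l := by
    simp [PiLp.inner_apply, Matrix.mul_apply, Matrix.star_apply, mul_comm]
  rw [h2, ← h1]
  ring

lemma orthonormal_iff_gramComplement {x : Fin k → WithLp 2 (E × F)} :
    Orthonormal ℂ x ↔ GramComplement (fun i => (x i).fst) (fun i => (x i).snd) := by
  rw [orthonormal_iff_ite]
  rfl

end Gram

/-! ### The closure of the joint range consists of compression points. -/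

section Compression

variable {E : Type*} [NormedAddCommGroup E] [InnerProductSpace ℂ E] {m : ℕ}

lemma mem_jointNumericalRange_iff {k : ℕ} {A : Fin m → E →L[ℂ] E} {a : Fin m → ℂ} :
    a ∈ jointNumericalRange k A ↔
      ∃ x : Fin k → E, Orthonormal ℂ x ∧ a = ∑ i, quadraticValue A (x i) := by
  refine exists_congr fun x => and_congr_right fun _ => ?_
  rw [funext_iff]
  simp [quadraticValue]

/-- The points `∑ ⟨A x_i, x_i⟩ + (∑ ‖y_i‖²) ξ`, where the Gram matrices of `x` and `y` add up to
the identity and `ξ` lies in the joint essential numerical range. -/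
def compressionPoints (k : ℕ) (A : Fin m → E →L[ℂ] E) : Set (Fin m → ℂ) :=
  {a | ∃ (x : Fin k → E) (y : Fin k → EuclideanSpace ℂ (Fin k)), GramComplement x y ∧
    ∃ ξ ∈ essNumericalRange A, a = ∑ i, quadraticValue A (x i) + (∑ i, ‖y i‖ ^ 2) • ξ}

lemma quadraticValue_sum_of_pairwise {ι : Type*} [Fintype ι] (A : Fin m → E →L[ℂ] E) (u : ι → E)
    (hu : ∀ a b, a ≠ b → ∀ j, inner ℂ (u a) (A j (u b)) = 0) (c : ι → ℂ) :
    quadraticValue A (∑ a, c a • u a) = ∑ a, (‖c a‖ ^ 2) • quadraticValue A (u a) := by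
  classical
  funext j
  simp only [quadraticValue, map_sum, map_smul, Finset.sum_apply, Pi.smul_apply, sum_inner,
    inner_sum]
  refine Finset.sum_congr rfl fun a _ => ?_
  rw [Finset.sum_eq_single a]
  · have h := congrFun (quadraticValue_smul A (c a) (u a)) j
    simpa only [quadraticValue, map_smul, Pi.smul_apply] using h
  · intro b _ hb
    rw [inner_smul_left, inner_smul_right, hu b a hb, mul_zero, mul_zero]
  · simp

/-- Near a point of the asymptotic range there are joint almost eigensystems of any size that are
orthogonal to a given finite set. -/
lemma exists_orthonormal_of_mem_asymptoticRange {A : Fin m → E →L[ℂ] E}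
    (hA : ∀ j, ((A j : E →L[ℂ] E) : E →ₗ[ℂ] E).IsSymmetric) {ξ : Fin m → ℂ}
    (hξ : ξ ∈ asymptoticRange A) {ε : ℝ} (hε : 0 < ε) (n : ℕ) (s : Finset E) :
    ∃ u : Fin n → E, Orthonormal ℂ u ∧ (∀ a, ∀ y ∈ s, inner ℂ y (u a) = 0) ∧
      (∀ a b, a ≠ b → ∀ j, inner ℂ (u a) (A j (u b)) = 0) ∧
      ∀ a, dist (quadraticValue A (u a)) ξ < ε := by
  classical
  induction n generalizing s with
  | zero => exact ⟨fun _ => 0, ⟨fun i => i.elim0, fun i => i.elim0⟩, fun i => i.elim0,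
      fun i => i.elim0, fun i => i.elim0⟩
  | succ n ih =>
    obtain ⟨x, hx1, hxs, hx⟩ := exists_of_mem_asymptoticRange hξ s hε
    obtain ⟨u, hu, hus, huA, huξ⟩ := ih (s ∪ {x} ∪ Finset.univ.image fun j => A j x)
    have hxu : ∀ a, inner ℂ x (u a) = 0 := fun a => hus a x (by simp)
    have hAxu : ∀ a j, inner ℂ (A j x) (u a) = 0 := fun a j => hus a _ (by simp)
    refine ⟨Fin.cons x u, ?_, ?_, ?_, ?_⟩
    · rw [orthonormal_iff_ite] at hu ⊢
      intro i l
      refine Fin.cases ?_ (fun i => ?_) i <;> refine Fin.cases ?_ (fun l => ?_) l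
      · simp [hx1]
      · simp [hxu, (Fin.succ_ne_zero l).symm]
      · have := inner_eq_zero_symm.1 (hxu i)
        simp [this]
      · simp [hu]
    · intro a y hy
      refine Fin.cases ?_ (fun a => ?_) a
      · exact hxs y hy
      · exact hus a y (by simp [hy])
    · intro a b hab j
      revert hab
      refine Fin.cases ?_ (fun a => ?_) a <;> refine Fin.cases ?_ (fun b => ?_) b
      · simp
      · intro _
        exact (hA j x (u b)).symm.trans (hAxu b j)
      · intro _
        exact inner_eq_zero_symm.1 (hAxu a j)
      · intro hab
        exact huA a b (fun h => hab (by rw [h])) j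
    · intro a
      refine Fin.cases ?_ (fun a => ?_) a
      · exact hx
      · exact huξ a

/-- The vectors `x i + ∑ a, y i a • u a` are orthonormal because the `u a` are orthogonal to all `x
i` and transport the Gram matrix of `y`. Orthogonality to `A j (x i)` removes the cross terms. -/
lemma compressionPoints_subset_closure (hE : ¬ FiniteDimensional ℂ E) {A : Fin m → E →L[ℂ] E}
    (hA : ∀ j, ((A j : E →L[ℂ] E) : E →ₗ[ℂ] E).IsSymmetric) (k : ℕ) :
    compressionPoints k A ⊆ closure (jointNumericalRange k A) := by
  classical
  rintro a ⟨x, y, hxy, ξ, hξ, rfl⟩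
  rw [essNumericalRange_eq_asymptoticRange hE hA] at hξ
  refine Metric.mem_closure_iff.2 fun ε hε => ?_
  set T : ℝ := ∑ i, ‖y i‖ ^ 2 with hT
  have hT0 : 0 ≤ T := Finset.sum_nonneg fun i _ => sq_nonneg _
  -- The errors have total weight `T`; the `+ 1` keeps the denominator positive and the final bound
  -- strict.
  obtain ⟨u, hu, hus, huA, huξ⟩ := exists_orthonormal_of_mem_asymptoticRange hA hξ
    (show 0 < ε / (T + 1) by positivity) k
    (Finset.univ.image x ∪ Finset.univ.image fun p : Fin m × Fin k => A p.1 (x p.2))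
  have hxu : ∀ i a, inner ℂ (x i) (u a) = 0 := fun i a => hus a _ (by simp)
  have hAxu : ∀ j i a, inner ℂ (A j (x i)) (u a) = 0 := fun j i a => hus a _ (by
    refine Finset.mem_union_right _ (Finset.mem_image.2 ⟨(j, i), by simp, rfl⟩))
  have hval : ∀ i, quadraticValue A (x i + ∑ a, y i a • u a) =
      quadraticValue A (x i) + ∑ a, (‖y i a‖ ^ 2) • quadraticValue A (u a) := fun i => by
    rw [quadraticValue_add_of_inner_eq_zero hA, quadraticValue_sum_of_pairwise A u huA]
    intro j
    rw [inner_sum]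
    exact Finset.sum_eq_zero fun a _ => by rw [inner_smul_right, hAxu, mul_zero]
  refine ⟨∑ i, quadraticValue A (x i + ∑ a, y i a • u a), mem_jointNumericalRange_iff.2
    ⟨_, ?_, rfl⟩, ?_⟩
  · rw [orthonormal_iff_ite]
    intro i l
    have h1 : ∀ i l, inner ℂ (x i) (∑ a, y l a • u a) = 0 := fun i l => by
      rw [inner_sum]
      exact Finset.sum_eq_zero fun a _ => by rw [inner_smul_right, hxu, mul_zero]
    have h2 : inner ℂ (∑ a, y i a • u a) (x l) = 0 := inner_eq_zero_symm.1 (h1 l i)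
    rw [inner_add_left, inner_add_right, inner_add_right, h1, h2, add_zero, zero_add,
      hu.inner_sum, ← hxy i l]
    simp [PiLp.inner_apply, mul_comm]
  · have h1 : ∑ i, quadraticValue A (x i) + T • ξ -
        ∑ i, quadraticValue A (x i + ∑ a, y i a • u a) =
        ∑ i, ∑ a, (‖y i a‖ ^ 2) • (ξ - quadraticValue A (u a)) := by
      simp_rw [hval, Finset.sum_add_distrib, smul_sub, Finset.sum_sub_distrib, hT,
        EuclideanSpace.norm_sq_eq, Finset.sum_smul]
      abel
    rw [dist_eq_norm, h1]
    calc ‖∑ i, ∑ a, (‖y i a‖ ^ 2) • (ξ - quadraticValue A (u a))‖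
        ≤ ∑ i, ∑ a, ‖y i a‖ ^ 2 * (ε / (T + 1)) := by
          refine (norm_sum_le _ _).trans (Finset.sum_le_sum fun i _ => (norm_sum_le _ _).trans
            (Finset.sum_le_sum fun a _ => ?_))
          rw [norm_smul, Real.norm_of_nonneg (sq_nonneg _)]
          gcongr
          rw [← dist_eq_norm, dist_comm]
          exact (huξ a).le
      _ = T * (ε / (T + 1)) := by
          simp_rw [← Finset.sum_mul, hT, EuclideanSpace.norm_sq_eq]
      _ < ε := by
          rw [mul_div_assoc', div_lt_iff₀ (by positivity)]
          nlinarith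

/-- Banach–Alaoglu, transported to `E` by the Riesz isomorphism. -/
lemma exists_weak_limit [CompleteSpace E] {ι : Type*} (U : Ultrafilter ι) {x : ι → E} {C : ℝ}
    (hC : ∀ n, ‖x n‖ ≤ C) :
    ∃ x₀ : E, ∀ h : E, Tendsto (fun n => inner ℂ h (x n)) U (𝓝 (inner ℂ h x₀)) := by
  have hmem : ∀ᶠ n in (U : Filter ι), StrongDual.toWeakDual (InnerProductSpace.toDual ℂ E (x n)) ∈
      WeakDual.toStrongDual ⁻¹' Metric.closedBall (0 : StrongDual ℂ E) C :=
    Eventually.of_forall fun n => by simpa using hC n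
  obtain ⟨φ, -, hφ⟩ := (WeakDual.isCompact_closedBall (0 : StrongDual ℂ E) C).ultrafilter_le_nhds
    (U.map fun n => StrongDual.toWeakDual (InnerProductSpace.toDual ℂ E (x n)))
    (le_principal_iff.2 hmem)
  have hφ' : Tendsto (fun n => StrongDual.toWeakDual (InnerProductSpace.toDual ℂ E (x n))) U
    (𝓝 φ) := hφ
  refine ⟨(InnerProductSpace.toDual ℂ E).symm (WeakDual.toStrongDual φ), fun h => ?_⟩
  have h1 := ((WeakDual.eval_continuous h).tendsto φ).comp hφ'
  have h2 := (Complex.continuous_conj.tendsto _).comp h1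
  rw [← inner_conj_symm, InnerProductSpace.toDual_symm_apply]
  refine h2.congr fun n => ?_
  exact inner_conj_symm _ _

lemma norm_le_of_weak_limit {ι : Type*} {l : Filter ι} [l.NeBot] {x : ι → E} {x₀ : E} {C : ℝ}
    (hC0 : 0 ≤ C) (hC : ∀ n, ‖x n‖ ≤ C)
    (h : ∀ h : E, Tendsto (fun n => inner ℂ h (x n)) l (𝓝 (inner ℂ h x₀))) : ‖x₀‖ ≤ C := by
  have h1 : ‖(inner ℂ x₀ x₀ : ℂ)‖ ≤ ‖x₀‖ * C :=
    le_of_tendsto (h x₀).norm (Eventually.of_forall fun n =>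
      (norm_inner_le_norm _ _).trans (by gcongr; exact hC n))
  rw [inner_self_eq_ofReal_norm_sq, Complex.norm_real, Real.norm_of_nonneg (sq_nonneg _), sq] at h1
  rcases eq_or_ne ‖x₀‖ 0 with h0 | h0
  · rwa [h0]
  · exact le_of_mul_le_mul_left h1 (lt_of_le_of_ne (norm_nonneg _) h0.symm)

/-- The defect of the quadratic values under weak convergence is a multiple of an essential
point. -/
lemma exists_quadraticValue_defect (hE : ¬ FiniteDimensional ℂ E) {A : Fin m → E →L[ℂ] E}
    (hA : ∀ j, ((A j : E →L[ℂ] E) : E →ₗ[ℂ] E).IsSymmetric) {ι : Type*} {U : Ultrafilter ι}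
    {x : ι → E} {x₀ : E} (hx : ∀ n, ‖x n‖ = 1)
    (hw : ∀ h : E, Tendsto (fun n => inner ℂ h (x n)) U (𝓝 (inner ℂ h x₀))) :
    ∃ v ∈ (1 - ‖x₀‖ ^ 2) • essNumericalRange A,
      Tendsto (fun n => quadraticValue A (x n)) U (𝓝 (quadraticValue A x₀ + v)) := by
  have hx₀ : ‖x₀‖ ≤ 1 := norm_le_of_weak_limit zero_le_one (fun n => (hx n).le) hw
  have h0 : ∀ h : E, Tendsto (fun n => inner ℂ h (x n - x₀)) U (𝓝 0) := fun h => by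
    simpa [inner_sub_right] using (hw h).sub_const (inner ℂ h x₀)
  have hbd : ∀ n, ‖x n - x₀‖ ≤ 2 := fun n =>
    (norm_sub_le _ _).trans (by rw [hx n]; linarith)
  have hK : IsCompact (Set.univ.pi fun j => Metric.closedBall (0 : ℂ) (‖A j‖ * 2 ^ 2)) :=
    isCompact_univ_pi fun j => isCompact_closedBall (0 : ℂ) _
  have hmem : ∀ᶠ n in (U : Filter ι), quadraticValue A (x n - x₀) ∈
      Set.univ.pi fun j => Metric.closedBall (0 : ℂ) (‖A j‖ * 2 ^ 2) := by
    refine Eventually.of_forall fun n j _ => ?_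
    rw [mem_closedBall_zero_iff]
    refine (norm_quadraticValue_apply_le A _ j).trans ?_
    gcongr
    exact hbd n
  obtain ⟨v, -, hv⟩ := hK.ultrafilter_le_nhds (U.map fun n => quadraticValue A (x n - x₀))
    (le_principal_iff.2 hmem)
  have hv' : Tendsto (fun n => quadraticValue A (x n - x₀)) U (𝓝 v) := hv
  have hs : Tendsto (fun n => ‖x n - x₀‖ ^ 2) U (𝓝 (1 - ‖x₀‖ ^ 2)) := by
    have h1 := (Complex.continuous_re.tendsto _).comp (hw x₀)
    have h2 : ∀ n, ‖x n - x₀‖ ^ 2 = 1 - 2 * (inner ℂ x₀ (x n) : ℂ).re + ‖x₀‖ ^ 2 := fun n => by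
      rw [norm_sub_sq (𝕜 := ℂ), hx n, inner_re_symm]
      simp
    simp_rw [h2]
    have h3 := ((h1.const_mul 2).const_sub 1).add_const (‖x₀‖ ^ 2)
    have h4 : 1 - 2 * (inner ℂ x₀ x₀ : ℂ).re + ‖x₀‖ ^ 2 = 1 - ‖x₀‖ ^ 2 := by
      rw [inner_self_eq_ofReal_norm_sq, Complex.ofReal_re]
      ring
    rwa [h4] at h3
  refine ⟨v, ?_, ?_⟩
  -- With no loss of norm the convergence is strong and `v = 0`; otherwise the weakly null
  -- differences, normalized, give an essential point.
  · rcases eq_or_ne (1 - ‖x₀‖ ^ 2) 0 with h1 | h1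
    · rw [h1, Set.zero_smul_set (essNumericalRange_nonempty hE A)]
      rw [h1] at hs
      refine Set.mem_zero.2 (tendsto_nhds_unique hv' (tendsto_pi_nhds.2 fun j => ?_))
      refine squeeze_zero_norm (fun n => norm_quadraticValue_apply_le A _ j) ?_
      simpa using hs.const_mul ‖A j‖
    · have h2 := mem_essNumericalRange_of_weakly_null (A := A) (Eventually.of_forall hbd) h0 h1 hs
        hv'
      exact ⟨_, h2, smul_inv_smul₀ h1 v⟩
  -- By symmetry the cross terms are conjugate to each other, and they tend to `0` weakly.
  · have h1 : ∀ n, quadraticValue A (x n) = (fun j => inner ℂ (A j x₀) (x n - x₀)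
        + (starRingEnd ℂ) (inner ℂ (A j x₀) (x n - x₀))) +
        (quadraticValue A x₀ + quadraticValue A (x n - x₀)) := fun n => by
      funext j
      have h2 : inner ℂ (A j x₀) (x n - x₀) = inner ℂ x₀ (A j (x n - x₀)) := hA j _ _
      simp only [quadraticValue, Pi.add_apply]
      rw [inner_conj_symm, h2]
      simp only [map_sub, inner_sub_left, inner_sub_right]
      ring
    simp_rw [h1]
    have h2 : Tendsto (fun n => fun j => inner ℂ (A j x₀) (x n - x₀)
        + (starRingEnd ℂ) (inner ℂ (A j x₀) (x n - x₀))) U (𝓝 (0 : Fin m → ℂ)) := by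
      refine tendsto_pi_nhds.2 fun j => ?_
      have h3 := (h0 (A j x₀)).add ((Complex.continuous_conj.tendsto _).comp (h0 (A j x₀)))
      simpa using h3
    simpa using h2.add (hv'.const_add (quadraticValue A x₀))

/-- One ultrafilter supplies all weak limits and defects simultaneously. Weak lower semicontinuity
of the norm bounds the limiting Gram matrix by the identity, and convexity merges the `k` defects.
-/
lemma closure_subset_compressionPoints [CompleteSpace E] (hE : ¬ FiniteDimensional ℂ E)
    {A : Fin m → E →L[ℂ] E} (hA : ∀ j, ((A j : E →L[ℂ] E) : E →ₗ[ℂ] E).IsSymmetric) (k : ℕ) :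
    closure (jointNumericalRange k A) ⊆ compressionPoints k A := by
  intro a ha
  obtain ⟨b, hb, hlim⟩ := mem_closure_iff_seq_limit.1 ha
  choose X hX hbX using fun n => mem_jointNumericalRange_iff.1 (hb n)
  set U : Ultrafilter ℕ := hyperfilter ℕ
  have hlimU : Tendsto b U (𝓝 a) := hlim.mono_left Nat.hyperfilter_le_atTop
  choose x hx using fun i => exists_weak_limit U (x := fun n => X n i) (C := 1)
    fun n => ((hX n).1 i).le
  choose v hv hvlim using fun i => exists_quadraticValue_defect hE hA (x := fun n => X n i)
    (fun n => (hX n).1 i) (hx i)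
  have hcontr : ∀ c : Fin k → ℂ, ‖∑ i, c i • x i‖ ^ 2 ≤ ∑ i, ‖c i‖ ^ 2 := by
    intro c
    have h1 : ∀ n, ‖∑ i, c i • X n i‖ ^ 2 = ∑ i, ‖c i‖ ^ 2 := fun n => by
      have h2 := (hX n).inner_sum c c Finset.univ
      rw [inner_self_eq_ofReal_norm_sq] at h2
      simp_rw [Complex.conj_mul'] at h2
      exact_mod_cast h2
    have h3 := norm_le_of_weak_limit (l := (U : Filter ℕ)) (x := fun n => ∑ i, c i • X n i)
      (x₀ := ∑ i, c i • x i) (Real.sqrt_nonneg (∑ i, ‖c i‖ ^ 2))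
      (fun n => Real.le_sqrt_of_sq_le (h1 n).le) (fun h => by
        simp_rw [inner_sum, inner_smul_right]
        exact tendsto_finsetSum _ fun i _ => (hx i h).const_mul _)
    calc ‖∑ i, c i • x i‖ ^ 2 ≤ √(∑ i, ‖c i‖ ^ 2) ^ 2 := by gcongr
      _ = _ := Real.sq_sqrt (Finset.sum_nonneg fun i _ => sq_nonneg _)
  obtain ⟨y, hxy⟩ := exists_gramComplement x hcontr
  have hsq : ∀ i, 1 - ‖x i‖ ^ 2 = ‖y i‖ ^ 2 := fun i => by linarith [hxy.norm_sq i]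
  obtain ⟨ξ, hξ, hξv⟩ := sum_mem_smul_of_convex (convex_essNumericalRange hA)
    (essNumericalRange_nonempty hE A) Finset.univ (s := fun i => ‖y i‖ ^ 2) (v := v)
    (fun i _ => sq_nonneg _) (fun i _ => hsq i ▸ hv i)
  refine ⟨x, y, hxy, ξ, hξ, ?_⟩
  have h4 : Tendsto b U (𝓝 (∑ i, (quadraticValue A (x i) + v i))) := by
    have h5 := tendsto_finsetSum Finset.univ fun i _ => hvlim i
    exact h5.congr fun n => (hbX n).symm
  rw [tendsto_nhds_unique hlimU h4, Finset.sum_add_distrib]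
  congr 1
  exact hξv.symm

end Compression

/-! ### The diagonal operators and the extended tuple. -/

section Extension

variable {E : Type*} [NormedAddCommGroup E] [InnerProductSpace ℂ E] {m : ℕ}

lemma quadraticValue_ampliation {F : Type*} [NormedAddCommGroup F] [InnerProductSpace ℂ F] (k : ℕ)
    (T : Fin m → F →L[ℂ] F) (w : PiLp 2 fun _ : Fin k => F) :
    quadraticValue (fun j => ampliation k (T j)) w = ∑ i, quadraticValue T (w i) := by
  funext j
  rw [Finset.sum_apply]
  exact PiLp.inner_apply _ _

lemma quadraticValue_extendedTuple (k : ℕ) (A : Fin m → E →L[ℂ] E)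
    (z : WithLp 2 (E × PiLp 2 (fun _ : Fin k => EssSpace A))) :
    quadraticValue (extendedTuple k A) z = quadraticValue A z.fst +
      quadraticValue (fun j => ampliation k (essDiagonal A j)) z.snd := by
  funext j
  exact WithLp.prod_inner_apply _ _

lemma essDiagonal_apply (A : Fin m → E →L[ℂ] E) (j : Fin m) (f : EssSpace A)
    (μ : essNumericalRange A) : essDiagonal A j f μ = (μ : Fin m → ℂ) j * f μ := by
  simp [essDiagonal]

/-- The value is the series `∑ ‖f μ‖² μ`. Convexity handles its partial sums, compactness the limit.
-/
lemma quadraticValue_essDiagonal_mem {A : Fin m → E →L[ℂ] E}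
    (hA : ∀ j, ((A j : E →L[ℂ] E) : E →ₗ[ℂ] E).IsSymmetric)
    (hne : (essNumericalRange A).Nonempty) (f : EssSpace A) :
    quadraticValue (essDiagonal A) f ∈ ‖f‖ ^ 2 • essNumericalRange A := by
  have h1 : HasSum (fun μ : essNumericalRange A => ‖f μ‖ ^ 2) (‖f‖ ^ 2) := by
    have h := lp.hasSum_norm (p := 2) (by simp) f
    simpa using h
  have h2 : HasSum (fun μ : essNumericalRange A => (‖f μ‖ ^ 2) • (μ : Fin m → ℂ))
      (quadraticValue (essDiagonal A) f) := by
    rw [Pi.hasSum]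
    intro j
    have h3 := lp.hasSum_inner (𝕜 := ℂ) f (essDiagonal A j f)
    have h4 : ∀ μ : essNumericalRange A, inner ℂ (f μ) (essDiagonal A j f μ) =
        ((‖f μ‖ ^ 2) • (μ : Fin m → ℂ)) j := fun μ => by
      rw [essDiagonal_apply, ← smul_eq_mul, inner_smul_right, inner_self_eq_ofReal_norm_sq,
        Pi.smul_apply, Complex.real_smul, mul_comm]
    simp only [h4] at h3
    exact h3
  refine mem_smul_of_tendsto (isCompact_essNumericalRange A) h1 h2 fun t => ?_
  exact sum_mem_smul_of_convex (convex_essNumericalRange hA) hne t (fun _ _ => sq_nonneg _)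
    fun μ _ => Set.smul_mem_smul_set μ.2

lemma quadraticValue_ampliation_essDiagonal_mem {A : Fin m → E →L[ℂ] E}
    (hA : ∀ j, ((A j : E →L[ℂ] E) : E →ₗ[ℂ] E).IsSymmetric)
    (hne : (essNumericalRange A).Nonempty) (k : ℕ) (w : PiLp 2 fun _ : Fin k => EssSpace A) :
    quadraticValue (fun j => ampliation k (essDiagonal A j)) w ∈
      ‖w‖ ^ 2 • essNumericalRange A := by
  rw [quadraticValue_ampliation, PiLp.norm_sq_eq_of_L2]
  exact sum_mem_smul_of_convex (convex_essNumericalRange hA) hne _ (fun _ _ => sq_nonneg _)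
    fun i _ => quadraticValue_essDiagonal_mem hA hne (w i)

open Classical in
/-- The basis vector `e_μ` in the copy with index `a`. -/
noncomputable def essBasisVector (k : ℕ) (A : Fin m → E →L[ℂ] E) (μ : essNumericalRange A)
    (a : Fin k) : PiLp 2 fun _ : Fin k => EssSpace A :=
  WithLp.toLp 2 (Pi.single a (lp.single 2 μ 1))

lemma orthonormal_essBasisVector (k : ℕ) (A : Fin m → E →L[ℂ] E) (μ : essNumericalRange A) :
    Orthonormal ℂ (essBasisVector k A μ) := by
  classical
  rw [orthonormal_iff_ite]
  intro a b
  rw [PiLp.inner_apply, Finset.sum_eq_single a]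
  · by_cases hab : a = b
    · subst hab
      simp [essBasisVector]
    · simp [essBasisVector, hab]
  · intro c _ hc
    simp [essBasisVector, hc]
  · simp

lemma ampliation_essBasisVector (k : ℕ) (A : Fin m → E →L[ℂ] E) (μ : essNumericalRange A)
    (a : Fin k) (j : Fin m) : ampliation k (essDiagonal A j) (essBasisVector k A μ a) =
      (μ : Fin m → ℂ) j • essBasisVector k A μ a := by
  classical
  ext i ν
  show essDiagonal A j ((Pi.single a (lp.single 2 μ 1) : Fin k → EssSpace A) i) ν =
    (μ : Fin m → ℂ) j * ((Pi.single a (lp.single 2 μ 1) : Fin k → EssSpace A) i) ν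
  rw [essDiagonal_apply]
  rcases eq_or_ne i a with rfl | hi
  · rw [Pi.single_eq_same, lp.single_apply]
    rcases eq_or_ne ν μ with rfl | hν
    · rfl
    · simp [hν]
  · rw [Pi.single_eq_of_ne hi]
    simp

lemma quadraticValue_essBasisVector (k : ℕ) (A : Fin m → E →L[ℂ] E) (μ : essNumericalRange A)
    (a : Fin k) :
    quadraticValue (fun j => ampliation k (essDiagonal A j)) (essBasisVector k A μ a) = μ := by
  funext j
  rw [quadraticValue, ampliation_essBasisVector, inner_smul_right, inner_self_eq_ofReal_norm_sq,
    (orthonormal_essBasisVector k A μ).1]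
  simp

lemma jointNumericalRange_ampliation_essDiagonal {A : Fin m → E →L[ℂ] E}
    (hA : ∀ j, ((A j : E →L[ℂ] E) : E →ₗ[ℂ] E).IsSymmetric) {k l : ℕ} (hl : 1 ≤ l) (hlk : l ≤ k) :
    jointNumericalRange l (fun j => ampliation k (essDiagonal A j)) =
      (fun μ : Fin m → ℂ => (l : ℂ) • μ) '' essNumericalRange A := by
  ext a
  rw [mem_jointNumericalRange_iff]
  constructor
  · rintro ⟨w, hw, rfl⟩
    have hne : (essNumericalRange A).Nonempty := by
      by_contra hemp
      have : IsEmpty (essNumericalRange A) :=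
        Set.isEmpty_coe_sort.2 (Set.not_nonempty_iff_eq_empty.1 hemp)
      have h0 : w ⟨0, hl⟩ = 0 := by
        ext i μ
        exact isEmptyElim μ
      have h1 := hw.1 ⟨0, hl⟩
      rw [h0, norm_zero] at h1
      exact zero_ne_one h1
    obtain ⟨ξ, hξ, h⟩ := sum_mem_smul_of_convex (convex_essNumericalRange hA) hne Finset.univ
      (s := fun i => ‖w i‖ ^ 2) (fun i _ => sq_nonneg _)
      fun i _ => quadraticValue_ampliation_essDiagonal_mem hA hne k (w i)
    refine ⟨ξ, hξ, ?_⟩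
    rw [← h]
    funext j
    simp [hw.1]
  · rintro ⟨μ, hμ, rfl⟩
    refine ⟨fun i => essBasisVector k A ⟨μ, hμ⟩ (Fin.castLE hlk i),
      (orthonormal_essBasisVector k A ⟨μ, hμ⟩).comp _ (Fin.castLE_injective hlk), ?_⟩
    simp only [quadraticValue_essBasisVector]
    funext j
    simp

/-- Conversely to compressing, the `k` copies of `e_ξ` span a `k`-dimensional space on which the
form is the scalar `ξ`, so any `y` embeds there. -/
lemma jointNumericalRange_extendedTuple (hE : ¬ FiniteDimensional ℂ E) {A : Fin m → E →L[ℂ] E}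
    (hA : ∀ j, ((A j : E →L[ℂ] E) : E →ₗ[ℂ] E).IsSymmetric) (k : ℕ) :
    jointNumericalRange k (extendedTuple k A) = compressionPoints k A := by
  have hne := essNumericalRange_nonempty hE A
  ext a
  rw [mem_jointNumericalRange_iff]
  constructor
  · rintro ⟨z, hz, rfl⟩
    rw [orthonormal_iff_gramComplement] at hz
    -- The `H₀` components are replaced by vectors of `ℂ^k` with the same norms, as
    -- `compressionPoints` requires.
    obtain ⟨y, hy⟩ := exists_gramComplement (fun i => (z i).fst) fun c => by
      rw [← hz.norm_sq_add c]
      exact le_add_of_nonneg_right (sq_nonneg _)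
    obtain ⟨ξ, hξ, h⟩ := sum_mem_smul_of_convex (convex_essNumericalRange hA) hne Finset.univ
      (s := fun i => ‖(z i).snd‖ ^ 2) (fun i _ => sq_nonneg _)
      fun i _ => quadraticValue_ampliation_essDiagonal_mem hA hne k (z i).snd
    refine ⟨fun i => (z i).fst, y, hy, ξ, hξ, ?_⟩
    have h2 : ∀ i, ‖y i‖ ^ 2 = ‖(z i).snd‖ ^ 2 := fun i => by
      linarith [hy.norm_sq i, hz.norm_sq i]
    simp_rw [quadraticValue_extendedTuple, Finset.sum_add_distrib, h2]
    rw [← h]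
  · rintro ⟨x, y, hxy, ξ, hξ, rfl⟩
    set e := essBasisVector k A ⟨ξ, hξ⟩
    have he := orthonormal_essBasisVector k A ⟨ξ, hξ⟩
    refine ⟨fun i => WithLp.toLp 2 (x i, ∑ a, y i a • e a), ?_, ?_⟩
    · rw [orthonormal_iff_gramComplement]
      intro i l
      rw [← hxy i l]
      show inner ℂ (x i) (x l) + inner ℂ (∑ a, y i a • e a) (∑ a, y l a • e a) = _
      rw [he.inner_sum]
      simp [PiLp.inner_apply, mul_comm]
    · have h1 : ∀ i, quadraticValue (fun j => ampliation k (essDiagonal A j))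
          (∑ a, y i a • e a) = (‖y i‖ ^ 2) • ξ := fun i => by
        rw [quadraticValue_sum_of_pairwise, EuclideanSpace.norm_sq_eq, Finset.sum_smul]
        · simp only [e, quadraticValue_essBasisVector]
        · intro a b hab j
          rw [ampliation_essBasisVector, inner_smul_right, he.2 hab, mul_zero]
      have h2 : ∀ i, quadraticValue (extendedTuple k A) (WithLp.toLp 2 (x i, ∑ a, y i a • e a)) =
          quadraticValue A (x i) + (‖y i‖ ^ 2) • ξ := fun i =>
        (quadraticValue_extendedTuple k A _).trans (congrArg _ (h1 i))
      simp_rw [h2, Finset.sum_add_distrib, Finset.sum_smul]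

lemma jointNumericalRange_subset_extendedTuple (k : ℕ) (A : Fin m → E →L[ℂ] E) :
    jointNumericalRange k A ⊆ jointNumericalRange k (extendedTuple k A) := by
  intro a ha
  obtain ⟨x, hx, rfl⟩ := mem_jointNumericalRange_iff.1 ha
  refine mem_jointNumericalRange_iff.2 ⟨fun i => WithLp.toLp 2 (x i, 0), ?_, ?_⟩
  · rw [orthonormal_iff_gramComplement]
    intro i l
    show inner ℂ (x i) (x l) + inner ℂ (0 : PiLp 2 fun _ : Fin k => EssSpace A) 0 = _
    rw [inner_zero_right, add_zero]
    exact orthonormal_iff_ite.1 hx i l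
  · refine Finset.sum_congr rfl fun i _ => ?_
    rw [quadraticValue_extendedTuple]
    funext j
    simp [quadraticValue]

lemma jointNumericalRange_extendedTuple_of_isEmpty (k : ℕ) {A : Fin m → E →L[ℂ] E}
    (hne : essNumericalRange A = ∅) :
    jointNumericalRange k (extendedTuple k A) = jointNumericalRange k A := by
  refine Set.Subset.antisymm ?_ (jointNumericalRange_subset_extendedTuple k A)
  intro a ha
  have : IsEmpty (essNumericalRange A) := Set.isEmpty_coe_sort.2 hne
  have h0 : ∀ w : PiLp 2 (fun _ : Fin k => EssSpace A), w = 0 := fun w => by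
    ext i μ
    exact isEmptyElim μ
  obtain ⟨z, hz, rfl⟩ := mem_jointNumericalRange_iff.1 ha
  rw [orthonormal_iff_gramComplement] at hz
  refine mem_jointNumericalRange_iff.2 ⟨fun i => (z i).fst, ?_, ?_⟩
  · rw [orthonormal_iff_ite]
    intro i l
    have h1 := hz i l
    simp only at h1
    rwa [h0 (z i).snd, inner_zero_left, add_zero] at h1
  · refine Finset.sum_congr rfl fun i _ => ?_
    rw [quadraticValue_extendedTuple, h0 (z i).snd]
    funext j
    simp [quadraticValue]

lemma isClosed_jointNumericalRange_of_finiteDimensional [FiniteDimensional ℂ E] (k : ℕ)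
    (A : Fin m → E →L[ℂ] E) : IsClosed (jointNumericalRange k A) := by
  have : ProperSpace E := FiniteDimensional.proper ℂ E
  have h1 : IsCompact {x : Fin k → E | Orthonormal ℂ x} := by
    refine (isCompact_univ_pi fun _ => isCompact_closedBall (0 : E) 1).of_isClosed_subset ?_
      fun x hx i _ => by simp [hx.1 i]
    simp_rw [orthonormal_iff_ite, Set.ofPred_forall]
    refine isClosed_iInter fun i => isClosed_iInter fun l => isClosed_eq ?_ continuous_const
    fun_prop
  have h2 : jointNumericalRange k A =
      (fun x : Fin k → E => ∑ i, quadraticValue A (x i)) '' {x | Orthonormal ℂ x} := by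
    ext a
    rw [mem_jointNumericalRange_iff]
    exact exists_congr fun x => and_congr_right fun _ => eq_comm
  rw [h2]
  refine (h1.image ?_).isClosed
  refine continuous_finsetSum _ fun i _ => continuous_pi fun j => ?_
  simp only [quadraticValue]
  fun_prop

end Extension

/-! ### Positive contractions of finite rank. -/

section Trace

variable {E : Type*} [NormedAddCommGroup E] [InnerProductSpace ℂ E] {m : ℕ}

/-- `T` factors through `ℂ^n`, and `tr (S L) = tr (L S)` reduces the trace to the matrix `⟨x i, y
l⟩`. The span `W` of the `y i` serves as intermediate space, since it may exceed the range of `T`.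
-/
lemma finiteRankTrace_eq_sum_inner {n : ℕ} {T : E →L[ℂ] E} (x y : Fin n → E)
    (hT : ∀ v, T v = ∑ i, inner ℂ (x i) v • y i) :
    finiteRankTrace T = ∑ i, inner ℂ (x i) (y i) := by
  set W := Submodule.span ℂ (Set.range y) with hW
  have hyW : ∀ i, y i ∈ W := fun i => Submodule.subset_span ⟨i, rfl⟩
  have hRW : LinearMap.range (T : E →ₗ[ℂ] E) ≤ W := by
    rintro _ ⟨v, rfl⟩
    rw [ContinuousLinearMap.coe_coe, hT]
    exact Submodule.sum_mem _ fun i _ => Submodule.smul_mem _ _ (hyW i)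
  have : FiniteDimensional ℂ W := FiniteDimensional.span_of_finite ℂ (Set.finite_range y)
  have : FiniteDimensional ℂ (LinearMap.range (T : E →ₗ[ℂ] E)) :=
    Submodule.finiteDimensional_of_le hRW
  let L : W →ₗ[ℂ] (Fin n → ℂ) :=
    LinearMap.pi fun i => (innerSL ℂ (x i)).toLinearMap ∘ₗ W.subtype
  let S : (Fin n → ℂ) →ₗ[ℂ] W := Fintype.linearCombination ℂ fun i => (⟨y i, hyW i⟩ : W)
  have h1 : Submodule.inclusion hRW ∘ₗ ((T : E →ₗ[ℂ] E).rangeRestrict ∘ₗ W.subtype) = S ∘ₗ L := by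
    ext v
    simp [S, L, Fintype.linearCombination_apply, hT]
  calc finiteRankTrace T = LinearMap.trace ℂ (LinearMap.range (T : E →ₗ[ℂ] E))
        (((T : E →ₗ[ℂ] E).rangeRestrict ∘ₗ W.subtype) ∘ₗ Submodule.inclusion hRW) := rfl
    _ = LinearMap.trace ℂ W (S ∘ₗ L) := by rw [LinearMap.trace_comp_comm', h1]
    _ = LinearMap.trace ℂ (Fin n → ℂ) (L ∘ₗ S) := LinearMap.trace_comp_comm' _ _
    _ = ∑ i, inner ℂ (x i) (y i) := by
        rw [LinearMap.trace_eq_matrix_trace ℂ (Pi.basisFun ℂ (Fin n)), Matrix.trace]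
        refine Finset.sum_congr rfl fun i _ => ?_
        simp [S, L]

lemma inner_apply_self_eq_sum {k : ℕ} {P : E →L[ℂ] E} {x : Fin k → E}
    (hP : ∀ v, P v = ∑ i, inner ℂ (x i) v • x i) (v : E) :
    inner ℂ (P v) v = ((∑ i, ‖(inner ℂ (x i) v : ℂ)‖ ^ 2 : ℝ) : ℂ) := by
  rw [hP, sum_inner]
  push_cast
  exact Finset.sum_congr rfl fun i _ => by rw [inner_smul_left, Complex.conj_mul']

/-- In terms of `X c = ∑ c i • x i` this passes from `X X* ≤ 1` to `X* X ≤ 1`: Cauchy–Schwarz gives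
`‖w‖⁴ ≤ ‖c‖² ‖X* w‖² ≤ ‖c‖² ‖w‖²` for `w = X c`. -/
lemma norm_sum_smul_sq_le_of_norm_le_one {k : ℕ} {P : E →L[ℂ] E} {x : Fin k → E}
    (hP : ∀ v, P v = ∑ i, inner ℂ (x i) v • x i) (hP1 : ‖P‖ ≤ 1) (c : Fin k → ℂ) :
    ‖∑ i, c i • x i‖ ^ 2 ≤ ∑ i, ‖c i‖ ^ 2 := by
  set w := ∑ i, c i • x i with hw
  have h1 : ∑ i, ‖(inner ℂ (x i) w : ℂ)‖ ^ 2 ≤ ‖w‖ ^ 2 := by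
    have h2 := norm_inner_le_norm (𝕜 := ℂ) (P w) w
    rw [inner_apply_self_eq_sum hP, Complex.norm_real] at h2
    calc _ ≤ _ := le_abs_self _
      _ ≤ ‖P w‖ * ‖w‖ := h2
      _ ≤ 1 * ‖w‖ * ‖w‖ := by gcongr; exact P.le_of_opNorm_le hP1 w
      _ = ‖w‖ ^ 2 := by ring
  have h3 : ‖w‖ ^ 2 ≤ ∑ i, ‖c i‖ * ‖(inner ℂ (x i) w : ℂ)‖ := by
    have h4 : inner ℂ w w = ∑ i, (starRingEnd ℂ) (c i) * inner ℂ (x i) w := by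
      conv_lhs => rw [hw, sum_inner]
      exact Finset.sum_congr rfl fun i _ => inner_smul_left _ _ _
    have h5 : ‖(inner ℂ w w : ℂ)‖ = ‖w‖ ^ 2 := by
      rw [inner_self_eq_ofReal_norm_sq, Complex.norm_real, Real.norm_of_nonneg (sq_nonneg _)]
    rw [← h5, h4]
    refine (norm_sum_le _ _).trans (Finset.sum_le_sum fun i _ => ?_)
    rw [norm_mul, RCLike.norm_conj]
  have h6 := Finset.sum_mul_sq_le_sq_mul_sq Finset.univ (fun i => ‖c i‖)
    fun i => ‖(inner ℂ (x i) w : ℂ)‖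
  have hc0 : 0 ≤ ∑ i, ‖c i‖ ^ 2 := Finset.sum_nonneg fun i _ => sq_nonneg _
  rcases eq_or_lt_of_le (sq_nonneg ‖w‖) with h0 | h0
  · rwa [← h0]
  · refine le_of_mul_le_mul_right ?_ h0
    calc ‖w‖ ^ 2 * ‖w‖ ^ 2 ≤ (∑ i, ‖c i‖ * ‖(inner ℂ (x i) w : ℂ)‖) ^ 2 := by
          rw [← sq]
          gcongr
      _ ≤ _ := h6
      _ ≤ _ := by gcongr

lemma exists_contraction_of_gramComplement {F : Type*} [NormedAddCommGroup F]
    [InnerProductSpace ℂ F] {k : ℕ} {x : Fin k → E} {y : Fin k → F} (h : GramComplement x y) :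
    ∃ P : E →L[ℂ] E, P.IsPositive ∧ ‖P‖ ≤ 1 ∧
      LinearMap.rank (P : E →ₗ[ℂ] E) ≤ (k : Cardinal) ∧
      ∀ v, P v = ∑ i, inner ℂ (x i) v • x i := by
  have hP : ∀ v, (∑ i, InnerProductSpace.rankOne ℂ (x i) (x i)) v =
      ∑ i, inner ℂ (x i) v • x i := fun v => by
    simp [InnerProductSpace.rankOne_apply]
  set P : E →L[ℂ] E := ∑ i, InnerProductSpace.rankOne ℂ (x i) (x i)
  refine ⟨P, ⟨fun v w => ?_, fun v => ?_⟩, P.opNorm_le_bound zero_le_one fun v => ?_, ?_, hP⟩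
  · rw [ContinuousLinearMap.coe_coe, hP, hP, sum_inner, inner_sum]
    refine Finset.sum_congr rfl fun i _ => ?_
    rw [inner_smul_left, inner_smul_right, inner_conj_symm, mul_comm]
  · rw [ContinuousLinearMap.reApplyInnerSelf_apply, inner_apply_self_eq_sum hP]
    change 0 ≤ ∑ i, ‖(inner ℂ (x i) v : ℂ)‖ ^ 2
    exact Finset.sum_nonneg fun i _ => sq_nonneg _
  · rw [one_mul]
    have h1 : ‖P v‖ ^ 2 ≤ ∑ i, ‖(inner ℂ (x i) v : ℂ)‖ ^ 2 := by
      rw [hP, ← h.norm_sq_add fun i => inner ℂ (x i) v]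
      exact le_add_of_nonneg_right (sq_nonneg _)
    have h2 := norm_inner_le_norm (𝕜 := ℂ) (P v) v
    rw [inner_apply_self_eq_sum hP, Complex.norm_real] at h2
    have h3 : ‖P v‖ * ‖P v‖ ≤ ‖P v‖ * ‖v‖ := by
      rw [← sq]
      exact (h1.trans (le_abs_self _)).trans h2
    rcases eq_or_lt_of_le (norm_nonneg (P v)) with h0 | h0
    · rw [← h0]
      exact norm_nonneg v
    · exact le_of_mul_le_mul_left h3 h0
  · have hle : LinearMap.range (P : E →ₗ[ℂ] E) ≤ Submodule.span ℂ (Set.range x) := by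
      rintro _ ⟨v, rfl⟩
      rw [ContinuousLinearMap.coe_coe, hP]
      exact Submodule.sum_mem _ fun i _ => Submodule.smul_mem _ _ (Submodule.subset_span ⟨i, rfl⟩)
    have : FiniteDimensional ℂ (Submodule.span ℂ (Set.range x)) :=
      FiniteDimensional.span_of_finite ℂ (Set.finite_range x)
    refine (Submodule.rank_mono hle).trans ?_
    rw [← Module.finrank_eq_rank, Nat.cast_le]
    simpa [Set.finrank] using finrank_range_le_card (R := ℂ) x

/-- Diagonalize `P` on its finite-dimensional range and scale the eigenvectors by the square roots
of the eigenvalues; zero vectors pad the list to length `k`. -/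
lemma exists_eq_sum_inner_smul_of_isPositive {k : ℕ} {P : E →L[ℂ] E} (hP : P.IsPositive)
    (hk : LinearMap.rank (P : E →ₗ[ℂ] E) ≤ (k : Cardinal)) :
    ∃ x : Fin k → E, ∀ v, P v = ∑ i, inner ℂ (x i) v • x i := by
  set R := LinearMap.range (P : E →ₗ[ℂ] E) with hR
  have hfin : FiniteDimensional ℂ R :=
    Module.rank_lt_aleph0_iff.1 (hk.trans_lt (Cardinal.natCast_lt_aleph0))
  have hn : Module.finrank ℂ R ≤ k := by
    rw [LinearMap.rank, ← hR, ← Module.finrank_eq_rank, Nat.cast_le] at hk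
    exact hk
  have hsym : (P : E →ₗ[ℂ] E).IsSymmetric := hP.1
  have hinv : ∀ v ∈ R, (P : E →ₗ[ℂ] E) v ∈ R := fun v _ => ⟨v, rfl⟩
  have hsymR := hsym.restrict_invariant hinv
  obtain ⟨r, hr⟩ := Nat.exists_eq_add_of_le hn
  subst hr
  set u := hsymR.eigenvectorBasis rfl with hu
  set lam := hsymR.eigenvalues rfl with hlam
  have hPu : ∀ i, P (u i : E) = (lam i : ℂ) • (u i : E) := fun i =>
    congrArg Subtype.val (hsymR.apply_eigenvectorBasis rfl i)
  have hlam0 : ∀ i, 0 ≤ lam i := fun i => by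
    have h1 := hP.2 (u i : E)
    rw [ContinuousLinearMap.reApplyInnerSelf_apply, hPu, inner_smul_left,
      inner_self_eq_ofReal_norm_sq] at h1
    have h2 : ‖(u i : E)‖ = 1 := u.orthonormal.1 i
    simpa [h2] using h1
  refine ⟨Fin.append (fun i => ((√(lam i) : ℝ) : ℂ) • (u i : E)) fun _ => 0, fun v => ?_⟩
  rw [Fin.sum_univ_add]
  simp only [Fin.append_left, Fin.append_right, smul_zero, Finset.sum_const_zero, add_zero]
  have h3 := congrArg Subtype.val (u.sum_repr' ⟨P v, ⟨v, rfl⟩⟩)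
  have h4 : P v = ∑ i, inner ℂ (u i : E) (P v) • (u i : E) := by
    simpa using h3.symm
  rw [h4]
  refine Finset.sum_congr rfl fun i _ => ?_
  have h5 : inner ℂ (u i : E) (P v) = (lam i : ℂ) * inner ℂ (u i : E) v := by
    have h6 : inner ℂ (P (u i : E)) v = inner ℂ (u i : E) (P v) := hsym (u i : E) v
    rw [← h6, hPu, inner_smul_left, Complex.conj_ofReal]
  rw [h5, inner_smul_left, Complex.conj_ofReal, smul_smul]
  congr 1
  rw [mul_right_comm, ← Complex.ofReal_mul, Real.mul_self_sqrt (hlam0 i)]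

lemma finiteRankTrace_add_eq {k : ℕ} (A : Fin m → E →L[ℂ] E) {P : E →L[ℂ] E} {x : Fin k → E}
    (hP : ∀ v, P v = ∑ i, inner ℂ (x i) v • x i) {F : Type*} [NormedAddCommGroup F]
    [InnerProductSpace ℂ F] {y : Fin k → F} (h : GramComplement x y) (ξ : Fin m → ℂ) (j : Fin m) :
    finiteRankTrace (A j ∘L P) + ((k : ℂ) - finiteRankTrace P) * ξ j =
      (∑ i, quadraticValue A (x i) + (∑ i, ‖y i‖ ^ 2) • ξ) j := by
  have h1 : (k : ℂ) - ∑ i, inner ℂ (x i) (x i) = ((∑ i, ‖y i‖ ^ 2 : ℝ) : ℂ) := by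
    have h2 : ∀ i, ‖y i‖ ^ 2 = 1 - ‖x i‖ ^ 2 := fun i => by linarith [h.norm_sq i]
    simp_rw [h2, inner_self_eq_ofReal_norm_sq]
    push_cast
    simp
  rw [finiteRankTrace_eq_sum_inner x x hP,
    finiteRankTrace_eq_sum_inner (T := A j ∘L P) x (fun i => A j (x i)) fun v => by simp [hP], h1]
  simp [quadraticValue]

lemma tracePoints_eq_compressionPoints (k : ℕ) (A : Fin m → E →L[ℂ] E) :
    tracePoints k A = compressionPoints k A := by
  ext a
  constructor
  · rintro ⟨P, hP, hP1, hk, ξ, hξ, ha⟩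
    obtain ⟨x, hx⟩ := exists_eq_sum_inner_smul_of_isPositive hP hk
    obtain ⟨y, hy⟩ := exists_gramComplement x (norm_sum_smul_sq_le_of_norm_le_one hx hP1)
    exact ⟨x, y, hy, ξ, hξ, funext fun j => (ha j).trans (finiteRankTrace_add_eq A hx hy ξ j)⟩
  · rintro ⟨x, y, hy, ξ, hξ, rfl⟩
    obtain ⟨P, hP, hP1, hk, hx⟩ := exists_contraction_of_gramComplement hy
    exact ⟨P, hP, hP1, hk, ξ, hξ, fun j => (finiteRankTrace_add_eq A hx hy ξ j).symm⟩

end Trace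

/-! ### Conclusion. -/

lemma closure_jointNumericalRange {H : Type*} [NormedAddCommGroup H] [InnerProductSpace ℂ H]
    [CompleteSpace H] {m : ℕ} {A : Fin m → H →L[ℂ] H}
    (hA : ∀ j, ((A j : H →L[ℂ] H) : H →ₗ[ℂ] H).IsSymmetric) {k : ℕ}
    (hkH : (k : Cardinal) < Module.rank ℂ H) :
    closure (jointNumericalRange k A) = jointNumericalRange k (extendedTuple k A) := by
  by_cases hH : FiniteDimensional ℂ H
  · rw [(isClosed_jointNumericalRange_of_finiteDimensional k A).closure_eq]
    -- For `m = 0` the ambient space is a single point, so it suffices that `W_k(A)` is nonempty,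
    -- which follows from `k < dim H`.
    rcases Nat.eq_zero_or_pos m with rfl | hm
    · refine (jointNumericalRange_subset_extendedTuple k A).antisymm fun a _ => ?_
      have hk : k ≤ Module.finrank ℂ H := by
        rw [← Module.finrank_eq_rank, Nat.cast_lt] at hkH
        exact hkH.le
      exact ⟨fun i => stdOrthonormalBasis ℂ H (Fin.castLE hk i),
        (stdOrthonormalBasis ℂ H).orthonormal.comp _ (Fin.castLE_injective hk), fun j => j.elim0⟩
    · have : NeZero m := ⟨hm.ne'⟩
      exact (jointNumericalRange_extendedTuple_of_isEmpty k (essNumericalRange_eq_empty A)).symm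
  · rw [jointNumericalRange_extendedTuple hH hA]
    exact (closure_subset_compressionPoints hH hA k).antisymm
      (compressionPoints_subset_closure hH hA k)

end JointRange

theorem theorem4p3 {H : Type*} [NormedAddCommGroup H] [InnerProductSpace ℂ H] [CompleteSpace H]
    {m : ℕ} (A : Fin m → H →L[ℂ] H) (hA : ∀ j, IsSelfAdjoint (A j))
    (k : ℕ) (hk : 1 ≤ k) (hkH : (k : Cardinal) < Module.rank ℂ H) :
    (∀ ℓ : ℕ, 1 ≤ ℓ → ℓ ≤ k →
      JointRange.jointNumericalRange ℓ
          (fun j => JointRange.ampliation k (JointRange.essDiagonal A j)) =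
        (fun μ : Fin m → ℂ => (ℓ : ℂ) • μ) '' JointRange.essNumericalRange A) ∧
    closure (JointRange.jointNumericalRange k A) =
      JointRange.jointNumericalRange k (JointRange.extendedTuple k A) ∧
    (IsClosed (JointRange.jointNumericalRange k A) ↔
      JointRange.jointNumericalRange k A =
        JointRange.jointNumericalRange k (JointRange.extendedTuple k A)) ∧
    (¬ FiniteDimensional ℂ H →
      (IsClosed (JointRange.jointNumericalRange k A) ↔
        JointRange.jointNumericalRange k A = JointRange.tracePoints k A)) := by

  have hsym : ∀ j, ((A j : H →L[ℂ] H) : H →ₗ[ℂ] H).IsSymmetric := fun j => (hA j).isSymmetric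
  have hcl := JointRange.closure_jointNumericalRange hsym hkH
  have hclosed : IsClosed (JointRange.jointNumericalRange k A) ↔
      JointRange.jointNumericalRange k A =
        JointRange.jointNumericalRange k (JointRange.extendedTuple k A) := by
    rw [← hcl, eq_comm, closure_eq_iff_isClosed]
  refine ⟨fun l hl hlk => JointRange.jointNumericalRange_ampliation_essDiagonal hsym hl hlk, hcl,
    hclosed, fun hH => ?_⟩
  rw [JointRange.tracePoints_eq_compressionPoints,
    ← JointRange.jointNumericalRange_extendedTuple hH hsym]
  exact hclosed
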